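/- Let $A$ be a finite alphabet. A subshift $X\subseteq A^{\mathbb Z}$ is a nonempty closed set with $\sigma(X)=X$, where $\sigma(x)[i]=x[i+1]$ is the shift map; $X$ contains a fixed point if it contains a constant configuration, and it is trivial if it consists of a single configuration. Two subshifts are conjugate if there is a bijective sliding block code between them. For subshifts $Y\subseteq B^{\mathbb Z}$ and $Z\subseteq C^{\mathbb Z}$, the product $Y\times Z$ is regarded as a subshift over $B\times C$. $X$ is topologically direct prime if, whenever $X$ is conjugate to $Y\times Z$ for subshifts $Y,Z$ over finite alphabets, $Y$ or $Z$ is trivial. Write $x^-=x[-\infty,-1]$, $x^+=x[0,\infty]$, $X^{\pm}=\{x^{\pm}\mid x\in X\}$, and let $L(\cdot)$ denote the set of finite subwords (including the empty word). For $x^-\in X^-$ put $\omega(x^-)=\{y^+\in X^+\mid x^-y^+\in X\}$, and for $w\in L(X)$ put $\omega(w)=\{y^+\in X^+\mid wy^+\in X^+\}$. $X$ is sofic if $\{\omega(x^-)\mid x^-\in X^-\}$ is finite. $X$ is transitive if for all $u,v\in L(X)$ there is $w\in L(X)$ with $uwv\in L(X)$. A word $w\in L(X)$ is half-synchronizing if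 there is $x^-\in X^-$ with suffix $w$ such that $L(x^-)=L(X)$ and $\omega(x^-)=\omega(w)$; $X$ is half-synchronized if it is transitive and has a half-synchronizing word. The Krieger graph of $X$ has vertex set $\{\omega(x^-)\mid x^-\in X^-\}$ and, for all $x^-\in X^-$ and $a\in A$ with $x^-a\in X^-$, an edge from $\omega(x^-)$ to $\omega(x^-a)$ labeled $a$ (edges are identified when they have the same initial vertex, label and terminal vertex). If $X$ is half-synchronized, its Fischer graph is the maximal strongly connected subgraph of the Krieger graph that contains the vertex $\omega(w)$ for a half-synchronizing word $w$ (it does not depend on the choice of $w$). A nonempty finite path in a directed graph is a geodesic if no nonempty path with the same initial and terminal vertices is shorter. A bi-infinite path $p$ (a sequence of edges $p[i]$, $i\in\mathbb Z$) is eventually geodesic if there is $i_0\in\mathbb Z$ such that $p[i,i+n]$ is a geodesic for all $i\ge i_0$ and $n\ge 0$. Two bi-infinite paths $p,q$ are strictly proximal if for every $n\ge 0$ there is $i\ge 0$ with $p[i,i+n]=q[i,i+n]$, and $p[i]\ne q[i]$ for arbitrarily large $i$. **Theorem.** Let $X$ be a non-sofic half-synchronized subshift over a finite alphabet that contains a fixed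 point. If the Fischer graph of $X$ has no strictly proximal pair of bi-infinite paths $p,q$ such that both $p$ and $q$ are eventually geodesic, then $X$ is topologically direct prime. -/

import Mathlib

/-! ## Directed graphs and their paths -/

/-- A directed graph with vertex set `V` and edge set `E`, both possibly infinite. Loops and
parallel edges are allowed. -/
structure DirGraph (V E : Type*) where
  /-- The initial vertex of an edge. -/
  init : E → V
  /-- The terminal vertex of an edge. -/
  term : E → V

namespace DirGraph

variable {V E : Type*}

/-- `p` is a (nonempty, finite) path from `u` to `v`. -/
def IsPathFromTo (G : DirGraph V E) (u v : V) (p : List E) : Prop :=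
  List.IsChain (fun e f => G.term e = G.init f) p ∧
    ∃ hp : p ≠ [], G.init (p.head hp) = u ∧ G.term (p.getLast hp) = v

/-- There is a path from `u` to `v`. -/
def Reaches (G : DirGraph V E) (u v : V) : Prop :=
  ∃ p, G.IsPathFromTo u v p

/-- A finite path is a geodesic if it is a shortest path between its end vertices. -/
def IsGeodesic (G : DirGraph V E) (p : List E) : Prop :=
  ∃ u v, G.IsPathFromTo u v p ∧ ∀ q, G.IsPathFromTo u v q → p.length ≤ q.length

/-- The bi-infinite paths of the graph. -/
def biPaths (G : DirGraph V E) : Set (ℤ → E) :=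
  {x | ∀ i, G.term (x i) = G.init (x (i + 1))}

/-- A bi-infinite path all of whose subpaths `x[i, i + n]` with `i ≥ i₀` are geodesics,
for some `i₀`. -/
def IsEventuallyGeodesic (G : DirGraph V E) (x : ℤ → E) : Prop :=
  x ∈ G.biPaths ∧ ∃ i₀ : ℤ, ∀ i ≥ i₀, ∀ n : ℕ,
    G.IsGeodesic (List.ofFn fun k : Fin (n + 1) => x (i + (k : ℕ)))

/-- Two bi-infinite paths that agree on arbitrarily long segments `[i, i + n]` with `i ≥ 0`. -/
def IsProximalPair (G : DirGraph V E) (x y : ℤ → E) : Prop :=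
  x ∈ G.biPaths ∧ y ∈ G.biPaths ∧
    ∀ n : ℕ, ∃ i : ℕ, ∀ k : ℕ, k ≤ n → x ((i : ℤ) + k) = y ((i : ℤ) + k)

/-- A proximal pair that differs at arbitrarily large coordinates. -/
def IsStrictlyProximalPair (G : DirGraph V E) (x y : ℤ → E) : Prop :=
  G.IsProximalPair x y ∧ ∀ N : ℕ, ∃ i : ℕ, N ≤ i ∧ x i ≠ y i

/-- The graph has a strictly proximal pair of paths, both of which are eventually geodesic. -/
def HasEventuallyGeodesicStrictlyProximalPair (G : DirGraph V E) : Prop :=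
  ∃ x y, G.IsEventuallyGeodesic x ∧ G.IsEventuallyGeodesic y ∧ G.IsStrictlyProximalPair x y

/-- The subgraph with vertex set `S` and with all edges of `G` between vertices of `S`. -/
def induce (G : DirGraph V E) (S : Set V) :
    DirGraph S {e : E // G.init e ∈ S ∧ G.term e ∈ S} where
  init e := ⟨G.init e, e.2.1⟩
  term e := ⟨G.term e, e.2.2⟩

/-- The vertices that lie in the same strongly connected component as `v`. -/
def component (G : DirGraph V E) (v : V) : Set V :=
  {u | G.Reaches u v ∧ G.Reaches v u}

end DirGraph

/-! ## Subshifts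

Subshifts over a finite discrete alphabet `A` are elements of
`SymbolicDynamics.FullShift.Subshift A ℤ`. A right-infinite sequence `r[0] r[1] r[2] ⋯` is a
function `r : ℕ → A`, and a left-infinite sequence `⋯ x[-3] x[-2] x[-1]` is the function
`l : ℕ → A` with `l n = x[-(n + 1)]`. -/

namespace SymbolicDynamics.FullShift

variable {A : Type*}

/-- The word `x[i, i + n - 1]` of a configuration. -/
def subword (x : ℤ → A) (i : ℤ) (n : ℕ) : List A :=
  List.ofFn fun k : Fin n => x (i + (k : ℕ))

/-- The word of length `n` of a left-infinite sequence that is followed by exactly `m` further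
symbols, that is `x[-m - n, -m - 1]`. -/
def leftSubword (l : ℕ → A) (m n : ℕ) : List A :=
  (List.ofFn fun k : Fin n => l (m + k)).reverse

/-- The left-infinite part `x[-∞, -1]` of a configuration. -/
def leftRay (x : ℤ → A) : ℕ → A := fun n => x (Int.negSucc n)

/-- The right-infinite part `x[0, ∞]` of a configuration. -/
def rightRay (x : ℤ → A) : ℕ → A := fun n => x (Int.ofNat n)

/-- The configuration with left-infinite part `l` and right-infinite part `r`. -/
def glue (l r : ℕ → A) : ℤ → A
  | Int.ofNat n => r n
  | Int.negSucc n => l n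

/-- The concatenation of a word and a right-infinite sequence. -/
def prepend (w : List A) (r : ℕ → A) : ℕ → A :=
  fun n => if h : n < w.length then w[n] else r (n - w.length)

/-- The concatenation of a left-infinite sequence and one symbol. -/
def leftSnoc (l : ℕ → A) (a : A) : ℕ → A
  | 0 => a
  | n + 1 => l n

/-- The language of a left-infinite sequence. -/
def leftLanguage (l : ℕ → A) : Set (List A) :=
  {w | ∃ m n, leftSubword l m n = w}

namespace Subshift

variable [TopologicalSpace A]

/-- The language `L(X)`; it contains the empty word when `X` is nonempty. -/
def language (X : Subshift A ℤ) : Set (List A) :=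
  {w | ∃ x ∈ X.carrier, ∃ i n, subword x i n = w}

/-- The set `X⁻` of left-infinite parts. -/
def leftRays (X : Subshift A ℤ) : Set (ℕ → A) := leftRay '' X.carrier

/-- The set `X⁺` of right-infinite parts. -/
def rightRays (X : Subshift A ℤ) : Set (ℕ → A) := rightRay '' X.carrier

/-- The follower set of a left-infinite sequence. -/
def rayFollower (X : Subshift A ℤ) (l : ℕ → A) : Set (ℕ → A) :=
  {r | r ∈ X.rightRays ∧ glue l r ∈ X.carrier}

/-- The follower set of a word. -/
def wordFollower (X : Subshift A ℤ) (w : List A) : Set (ℕ → A) :=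
  {r | r ∈ X.rightRays ∧ prepend w r ∈ X.rightRays}

/-- Transitivity (irreducibility). -/
def IsTransitive (X : Subshift A ℤ) : Prop :=
  ∀ u ∈ X.language, ∀ v ∈ X.language, ∃ w ∈ X.language, u ++ w ++ v ∈ X.language

/-- `w` is a half-synchronizing word of `X`. -/
def IsHalfSynchronizing (X : Subshift A ℤ) (w : List A) : Prop :=
  w ∈ X.language ∧ ∃ l ∈ X.leftRays, leftSubword l 0 w.length = w ∧
    leftLanguage l = X.language ∧ X.rayFollower l = X.wordFollower w

/-- `X` is half-synchronized. -/
def IsHalfSynchronized (X : Subshift A ℤ) : Prop :=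
  X.IsTransitive ∧ ∃ w, X.IsHalfSynchronizing w

/-- The vertices of the Krieger graph: the follower sets of the elements of `X⁻`. -/
def kriegerVertices (X : Subshift A ℤ) : Set (Set (ℕ → A)) :=
  X.rayFollower '' X.leftRays

/-- `X` is sofic if its left-infinite parts have only finitely many follower sets. -/
def IsSofic (X : Subshift A ℤ) : Prop := X.kriegerVertices.Finite

/-- The edges of the Krieger graph, as triples (initial vertex, label, terminal vertex). -/
def kriegerEdges (X : Subshift A ℤ) : Set (X.kriegerVertices × A × X.kriegerVertices) :=
  {e | ∃ l ∈ X.leftRays, leftSnoc l e.2.1 ∈ X.leftRays ∧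
    (e.1 : Set (ℕ → A)) = X.rayFollower l ∧
    (e.2.2 : Set (ℕ → A)) = X.rayFollower (leftSnoc l e.2.1)}

/-- The Krieger graph of `X`. -/
def kriegerGraph (X : Subshift A ℤ) : DirGraph X.kriegerVertices X.kriegerEdges where
  init e := e.1.1
  term e := e.1.2.2

/-- The follower set of a half-synchronizing word, as a vertex of the Krieger graph. -/
def wordVertex (X : Subshift A ℤ) (w : List A) (hw : X.IsHalfSynchronizing w) :
    X.kriegerVertices :=
  ⟨X.wordFollower w, by
    obtain ⟨-, l, hl, -, -, hf⟩ := hw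
    exact ⟨l, hl, hf⟩⟩

/-- The Fischer graph of `X`: the maximal strongly connected subgraph of the Krieger graph that
contains the follower set of a half-synchronizing word `w`. -/
def fischerGraph (X : Subshift A ℤ) (w : List A) (hw : X.IsHalfSynchronizing w) :=
  X.kriegerGraph.induce (X.kriegerGraph.component (X.wordVertex w hw))

/-- `X` contains a fixed point of the shift. -/
def HasFixedPoint (X : Subshift A ℤ) : Prop :=
  ∃ x ∈ X.carrier, ∀ i, x (i + 1) = x i

/-- `X` contains only one configuration. -/
def IsTrivial (X : Subshift A ℤ) : Prop := ∃ x, X.carrier = {x}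

/-- `F` is a sliding block code: for some memory `m` and anticipation `a`, `F(x)[i]` is given by
a local rule applied to `x[i + m, i + a]`. -/
def IsSlidingBlockCode {B : Type*} [TopologicalSpace B] {X : Subshift A ℤ} {Y : Subshift B ℤ}
    (F : X.carrier → Y.carrier) : Prop :=
  ∃ m a : ℤ, m ≤ a ∧ ∃ f : (Set.Icc m a → A) → B,
    ∀ (x : X.carrier) (i : ℤ), (F x).1 i = f fun j => x.1 (i + j)

/-- `X` and `Y` are conjugate: there is a bijective sliding block code from `X` to `Y`. -/
def IsConjugate {B : Type*} [TopologicalSpace B] (X : Subshift A ℤ) (Y : Subshift B ℤ) : Prop :=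
  ∃ F : X.carrier → Y.carrier, IsSlidingBlockCode F ∧ Function.Bijective F

/-- The product of two subshifts, as a subshift over the product alphabet. -/
def prod {B C : Type*} [TopologicalSpace B] [TopologicalSpace C]
    (Y : Subshift B ℤ) (Z : Subshift C ℤ) : Subshift (B × C) ℤ where
  carrier := {x | (fun i => (x i).1) ∈ Y.carrier ∧ (fun i => (x i).2) ∈ Z.carrier}
  isClosed := by
    have h1 : Continuous fun x : ℤ → B × C => fun i => (x i).1 := by fun_prop
    have h2 : Continuous fun x : ℤ → B × C => fun i => (x i).2 := by fun_prop
    exact (Y.isClosed.preimage h1).inter (Z.isClosed.preimage h2)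
  mapsTo := fun g _ hx => ⟨Y.mapsTo g hx.1, Z.mapsTo g hx.2⟩

/-- `X` is topologically direct prime: whenever it is conjugate to a product of two (nonempty)
subshifts over finite alphabets, one of the two factors is trivial. -/
def IsDirectPrime.{u, v, w} {A : Type u} [TopologicalSpace A] (X : Subshift A ℤ) : Prop :=
  ∀ (B : Type v) (C : Type w) [Finite B] [Finite C] [TopologicalSpace B] [TopologicalSpace C]
    [DiscreteTopology B] [DiscreteTopology C] (Y : Subshift B ℤ) (Z : Subshift C ℤ),
    Y.carrier.Nonempty → Z.carrier.Nonempty → X.IsConjugate (Y.prod Z) →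
      Y.IsTrivial ∨ Z.IsTrivial

end Subshift

end SymbolicDynamics.FullShift

universe u v w

/-! Let `X` be conjugate to `Y × Z`. Follower sets in a product are products of follower sets. As
`X` is not sofic, infinitely many follower sets are reachable from a half-synchronizing vertex. This
survives the conjugacy, so it holds in one factor, say `Y`. The claim is then that `Z` is trivial.

Out-degrees are finite, so Kőnig's lemma gives a right-infinite geodesic `p` in `Y`. The base vertex
of `Z` is recurrent. If all its loops are powers of one word, then `Z` is a periodic orbit, and the
fixed point forces it to be trivial. Otherwise there are two distinct loops `a`, `b` of equal
length. Then `a a a ⋯` and the sequence with `b` exactly at the square positions are strictly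
proximal, as paths `q`, `q'` and not only as label sequences. Both `(p, q)` and `(p, q')` are
geodesic, because a shortcut in the product projects to a shortcut of `p`. A conjugacy preserves
such geodesics and strict proximality, so the Fischer graph of `X` has a forbidden pair.

Graphs are avoided until the end: a vertex is the follower set `followers x i`, and a path is a
continuation of a fixed past. The carrying lemmas are `IsConjugacy.followers_eq`,
`IsShortestFrom.image`, `IsHalfSyncConfig.exists_return`, `IsRecurrentAt.exists_loops_or_periodic`
and `IsHalfSyncConfig.hasEventuallyGeodesicStrictlyProximalPair`. -/

namespace SymbolicDynamics.FullShift

/-! ### Splicing of configurations, and follower sets -/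

section Configurations

variable {A : Type*}

/-- The configuration that agrees with `x` before coordinate `i` and continues with `r`. -/
def splice (x : ℤ → A) (i : ℤ) (r : ℕ → A) : ℤ → A :=
  fun j => if j < i then x j else r (j - i).toNat

/-- The right-infinite sequence `x[i, ∞]`. -/
def tail (x : ℤ → A) (i : ℤ) : ℕ → A := fun n => x (i + n)

/-- The first `n` symbols of `a`, followed by `r`. -/
def prependTake (a : ℕ → A) (n : ℕ) (r : ℕ → A) : ℕ → A :=
  fun i => if i < n then a i else r (i - n)

lemma splice_of_lt {x : ℤ → A} {i j : ℤ} {r : ℕ → A} (h : j < i) : splice x i r j = x j := by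
  simp [splice, h]

lemma splice_of_le {x : ℤ → A} {i j : ℤ} {r : ℕ → A} (h : i ≤ j) :
    splice x i r j = r (j - i).toNat := by
  simp [splice, not_lt.2 h]

lemma splice_add_nat (x : ℤ → A) (i : ℤ) (r : ℕ → A) (n : ℕ) : splice x i r (i + n) = r n := by
  rw [splice_of_le (by omega)]
  congr 1
  omega

lemma splice_tail_of_le {x y : ℤ → A} {i j t : ℤ} (h : i ≤ j) :
    splice x i (tail y t) j = y (t + (j - i)) := by
  rw [splice_of_le h, tail]
  congr 1
  omega

lemma tail_splice (x : ℤ → A) (i : ℤ) (r : ℕ → A) : tail (splice x i r) i = r :=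
  funext fun n => splice_add_nat x i r n

lemma config_ext {x y : ℤ → A} (i : ℤ) (h₁ : ∀ j < i, x j = y j) (h₂ : tail x i = tail y i) :
    x = y := by
  funext j
  rcases lt_or_ge j i with h | h
  · exact h₁ j h
  · have := congrFun h₂ (j - i).toNat
    simp only [tail] at this
    rwa [show i + ((j - i).toNat : ℤ) = j by omega] at this

lemma splice_tail_self (x : ℤ → A) (i : ℤ) : splice x i (tail x i) = x :=
  config_ext i (fun _ h => splice_of_lt h) (tail_splice _ _ _)

lemma splice_congr {x y : ℤ → A} {i : ℤ} (h : ∀ j < i, x j = y j) (r : ℕ → A) :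
    splice x i r = splice y i r :=
  config_ext i (fun j hj => by rw [splice_of_lt hj, splice_of_lt hj, h j hj])
    (by rw [tail_splice, tail_splice])

lemma splice_prependTake (x : ℤ → A) (i : ℤ) (n : ℕ) (r : ℕ → A) :
    splice x i (prependTake (tail x i) n r) = splice x (i + n) r := by
  funext j
  simp only [splice, prependTake, tail]
  split_ifs <;> first | rfl | omega | (congr 1; omega)

lemma splice_shift (x : ℤ → A) (t i : ℤ) (r : ℕ → A) :
    splice (shift t x) i r = shift t (splice x (t + i) r) := by
  funext j
  simp only [splice, shift]
  split_ifs <;> first | rfl | omega | (congr 1; omega)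

lemma prependTake_congr {a b : ℕ → A} {n : ℕ} (h : ∀ i < n, a i = b i) (r : ℕ → A) :
    prependTake a n r = prependTake b n r := by
  funext i
  simp only [prependTake]
  split_ifs with hi
  · exact h i hi
  · rfl

lemma glue_leftRay (x : ℤ → A) (r : ℕ → A) : glue (leftRay x) r = splice x 0 r := by
  funext j
  cases j with
  | ofNat n => simp [glue, splice]
  | negSucc n => simp [glue, splice, leftRay, Int.negSucc_lt_zero]

lemma rightRay_eq_tail (x : ℤ → A) : rightRay x = tail x 0 := by
  funext n
  simp [rightRay, tail]

/-- Every sequence of configurations over a finite alphabet has a limit along a subsequence. -/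
lemma exists_limit_config [Finite A] (p : ℕ → ℤ → A) :
    ∃ q : ℤ → A, ∀ M N : ℕ, ∃ n ≥ N, ∀ j : ℤ, |j| ≤ M → p n j = q j := by
  let _ : TopologicalSpace A := ⊥
  have : DiscreteTopology A := ⟨rfl⟩
  obtain ⟨q, -, hq⟩ := isCompact_univ.exists_mapClusterPt (f := Filter.atTop) (u := p)
    (by simp)
  refine ⟨q, fun M N => ?_⟩
  have hU : {x : ℤ → A | ∀ j : ℤ, |j| ≤ M → x j = q j} ∈ nhds q := by
    have : {x : ℤ → A | ∀ j : ℤ, |j| ≤ M → x j = q j} =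
        (Set.Icc (-(M : ℤ)) M).pi fun j => {q j} := by
      ext x
      simp [Set.pi, abs_le]
    rw [this]
    exact set_pi_mem_nhds (Set.finite_Icc _ _) fun j _ => by simp
  obtain ⟨n, hn, h⟩ := (Filter.frequently_atTop.1 (mapClusterPt_iff_frequently.1 hq _ hU)) N
  exact ⟨n, hn, h⟩

end Configurations

namespace Subshift

variable {A : Type*} [TopologicalSpace A]

lemma shift_mem (X : Subshift A ℤ) {x : ℤ → A} (hx : x ∈ X.carrier) (t : ℤ) :
    shift t x ∈ X.carrier := X.mapsTo t hx

lemma shift_mem_iff (X : Subshift A ℤ) {x : ℤ → A} (t : ℤ) :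
    shift t x ∈ X.carrier ↔ x ∈ X.carrier := by
  refine ⟨fun h => ?_, fun h => X.shift_mem h t⟩
  have := X.shift_mem h (-t)
  rwa [show shift (-t) (shift t x) = x from by funext j; simp [shift]] at this

lemma mem_of_approx (X : Subshift A ℤ) {x : ℤ → A}
    (h : ∀ N : ℕ, ∃ y ∈ X.carrier, ∀ j : ℤ, |j| ≤ N → y j = x j) : x ∈ X.carrier := by
  choose y hy hyx using h
  refine X.isClosed.mem_of_tendsto (b := Filter.atTop) (f := y) ?_ (Filter.Eventually.of_forall hy)
  refine tendsto_pi_nhds.2 fun j => ?_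
  refine tendsto_const_nhds.congr' ?_
  filter_upwards [Filter.eventually_ge_atTop j.natAbs] with n hn
  exact (hyx n j (abs_le.2 ⟨by omega, by omega⟩)).symm

/-- The right-infinite sequences that may follow `x[-∞, i - 1]`. -/
def followers (X : Subshift A ℤ) (x : ℤ → A) (i : ℤ) : Set (ℕ → A) :=
  {r | splice x i r ∈ X.carrier}

variable {X : Subshift A ℤ}

lemma mem_followers {x : ℤ → A} {i : ℤ} {r : ℕ → A} :
    r ∈ X.followers x i ↔ splice x i r ∈ X.carrier := Iff.rfl

lemma tail_mem_followers {x : ℤ → A} (hx : x ∈ X.carrier) (i : ℤ) :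
    tail x i ∈ X.followers x i := by
  rwa [mem_followers, splice_tail_self]

lemma followers_congr {x y : ℤ → A} {i : ℤ} (h : ∀ j < i, x j = y j) :
    X.followers x i = X.followers y i := by
  ext r
  rw [mem_followers, mem_followers, splice_congr h]

lemma followers_splice (x : ℤ → A) (i : ℤ) (r : ℕ → A) :
    X.followers (splice x i r) i = X.followers x i :=
  followers_congr fun _ h => splice_of_lt h

lemma followers_shift (x : ℤ → A) (t i : ℤ) :
    X.followers (shift t x) i = X.followers x (t + i) := by
  ext r
  rw [mem_followers, mem_followers, splice_shift, shift_mem_iff]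

lemma mem_followers_add {x : ℤ → A} {i : ℤ} {n : ℕ} {r : ℕ → A} :
    r ∈ X.followers x (i + n) ↔ prependTake (tail x i) n r ∈ X.followers x i := by
  rw [mem_followers, mem_followers, splice_prependTake]

/-- Equal follower sets remain equal when the same symbols are appended. -/
lemma followers_add_eq {x y : ℤ → A} {s t : ℤ} (h : X.followers x s = X.followers y t) (n : ℕ)
    (hxy : ∀ i < n, x (s + (i : ℕ)) = y (t + (i : ℕ))) :
    X.followers x (s + n) = X.followers y (t + n) := by
  ext r
  rw [mem_followers_add, mem_followers_add, h]
  rw [prependTake_congr (a := tail x s) (b := tail y t) hxy]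

lemma splice_tail_mem {x y : ℤ → A} {s t : ℤ} (h : X.followers x s = X.followers y t)
    (hy : y ∈ X.carrier) : splice x s (tail y t) ∈ X.carrier := by
  rw [← mem_followers, h]
  exact tail_mem_followers hy t

lemma mem_followers_of_approx {x : ℤ → A} {i : ℤ} {r : ℕ → A}
    (h : ∀ N : ℕ, ∃ r' ∈ X.followers x i, ∀ n < N, r' n = r n) : r ∈ X.followers x i := by
  refine mem_of_approx X fun N => ?_
  obtain ⟨r', hr', hrr⟩ := h (N + i.natAbs + 1)
  refine ⟨_, hr', fun j hj => ?_⟩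
  rcases lt_or_ge j i with hji | hji
  · rw [splice_of_lt hji, splice_of_lt hji]
  · rw [splice_of_le hji, splice_of_le hji]
    refine hrr _ ?_
    rw [abs_le] at hj
    omega

lemma rayFollower_leftRay (x : ℤ → A) : X.rayFollower (leftRay x) = X.followers x 0 := by
  ext r
  simp only [rayFollower, Set.mem_ofPred_eq, glue_leftRay, mem_followers, and_iff_right_iff_imp]
  intro h
  exact ⟨_, h, by rw [rightRay_eq_tail, tail_splice]⟩

end Subshift

end SymbolicDynamics.FullShift

/-! ### Conjugacies as pairs of local maps, and their effect on follower sets -/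

namespace SymbolicDynamics.FullShift.Subshift

variable {A B : Type*} [TopologicalSpace A] [TopologicalSpace B]

/-- `F` maps `X` into `W`, and `F x i` depends only on `x[i - k, i + k]`. -/
structure IsLocalMap (X : Subshift A ℤ) (W : Subshift B ℤ) (k : ℕ) (F : (ℤ → A) → ℤ → B) :
    Prop where
  maps : ∀ x ∈ X.carrier, F x ∈ W.carrier
  loc : ∀ x ∈ X.carrier, ∀ y ∈ X.carrier, ∀ s t : ℤ,
    (∀ j : ℤ, |j| ≤ k → x (s + j) = y (t + j)) → F x s = F y t

/-- `F` and `G` are mutually inverse local maps of radius `k`. -/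
structure IsConjugacy (X : Subshift A ℤ) (W : Subshift B ℤ) (k : ℕ) (F : (ℤ → A) → ℤ → B)
    (G : (ℤ → B) → ℤ → A) : Prop where
  fwd : X.IsLocalMap W k F
  bwd : W.IsLocalMap X k G
  left_inv : ∀ x ∈ X.carrier, G (F x) = x
  right_inv : ∀ w ∈ W.carrier, F (G w) = w

variable {X : Subshift A ℤ} {W : Subshift B ℤ} {k : ℕ} {F : (ℤ → A) → ℤ → B}
  {G : (ℤ → B) → ℤ → A}

lemma IsConjugacy.symm (h : X.IsConjugacy W k F G) : W.IsConjugacy X k G F :=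
  ⟨h.bwd, h.fwd, h.right_inv, h.left_inv⟩

lemma IsLocalMap.mono (h : X.IsLocalMap W k F) {l : ℕ} (hkl : k ≤ l) : X.IsLocalMap W l F :=
  ⟨h.maps, fun x hx y hy s t hxy => h.loc x hx y hy s t fun j hj =>
    hxy j (hj.trans (by exact_mod_cast hkl))⟩

lemma IsLocalMap.shift (h : X.IsLocalMap W k F) {x : ℤ → A} (hx : x ∈ X.carrier) (t : ℤ) :
    F (shift t x) = FullShift.shift t (F x) := by
  funext i
  exact h.loc _ (X.shift_mem hx t) _ hx _ _ fun j _ => by simp [FullShift.shift, add_assoc]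

lemma IsLocalMap.eq_of_agree (h : X.IsLocalMap W k F) {x y : ℤ → A} (hx : x ∈ X.carrier)
    (hy : y ∈ X.carrier) {s t : ℤ} (hxy : ∀ j : ℤ, -k ≤ j → j ≤ k → x (s + j) = y (t + j)) :
    F x s = F y t :=
  h.loc x hx y hy s t fun j hj => by
    rw [abs_le] at hj
    exact hxy j hj.1 hj.2

lemma IsLocalMap.eq_of_agree_lt (h : X.IsLocalMap W k F) {x y : ℤ → A} (hx : x ∈ X.carrier)
    (hy : y ∈ X.carrier) {t : ℤ} (hxy : ∀ j < t, x j = y j) {j : ℤ} (hj : j + k < t) :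
    F x j = F y j :=
  h.eq_of_agree hx hy fun i _ _ => hxy _ (by omega)

/-- An injective local map on a subshift over a finite alphabet has a local inverse. -/
lemma exists_radius_inverse [Finite A] (hF : X.IsLocalMap W k F)
    (hinj : ∀ x ∈ X.carrier, ∀ y ∈ X.carrier, F x = F y → x = y) :
    ∃ n : ℕ, ∀ x ∈ X.carrier, ∀ y ∈ X.carrier, (∀ j : ℤ, |j| ≤ n → F x j = F y j) →
      x 0 = y 0 := by
  by_contra! hcon
  choose x hx y hy hxy hne using hcon
  -- A limit of the counterexample pairs consists of two points with the same image that differ at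
  -- `0`.
  obtain ⟨q, hq⟩ := exists_limit_config fun n i => (x n i, y n i)
  have hq₁ : (fun i => (q i).1) ∈ X.carrier := mem_of_approx X fun N => by
    obtain ⟨n, -, h⟩ := hq N 0
    exact ⟨x n, hx n, fun j hj => by rw [← h j hj]⟩
  have hq₂ : (fun i => (q i).2) ∈ X.carrier := mem_of_approx X fun N => by
    obtain ⟨n, -, h⟩ := hq N 0
    exact ⟨y n, hy n, fun j hj => by rw [← h j hj]⟩
  have heq : (fun i => (q i).1) = fun i => (q i).2 := by
    refine hinj _ hq₁ _ hq₂ (funext fun i => ?_)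
    obtain ⟨n, hn, h⟩ := hq (i.natAbs + k) i.natAbs
    have h₁ : F (fun i => (q i).1) i = F (x n) i :=
      hF.eq_of_agree hq₁ (hx n) fun j _ _ => by
        rw [← h (i + j) (abs_le.2 ⟨by omega, by omega⟩)]
    have h₂ : F (fun i => (q i).2) i = F (y n) i :=
      hF.eq_of_agree hq₂ (hy n) fun j _ _ => by
        rw [← h (i + j) (abs_le.2 ⟨by omega, by omega⟩)]
    rw [h₁, h₂]
    exact hxy n i (abs_le.2 ⟨by omega, by omega⟩)
  obtain ⟨n, -, h⟩ := hq 0 0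
  have h0 := h 0 (by simp)
  apply hne n
  have := congrFun heq 0
  simp only [← h0] at this
  exact this

lemma IsConjugate.exists_isConjugacy [Finite A] (hne : X.carrier.Nonempty)
    (h : X.IsConjugate W) : ∃ k F G, X.IsConjugacy W k F G := by
  obtain ⟨Φ, ⟨m, a, hma, f, hf⟩, hinj, hsurj⟩ := h
  set F : (ℤ → A) → ℤ → B := fun x i => f fun j => x (i + j)
  have hΦ : ∀ x (hx : x ∈ X.carrier), F x = (Φ ⟨x, hx⟩).1 := fun x hx =>
    funext fun i => (hf ⟨x, hx⟩ i).symm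
  have hF : X.IsLocalMap W (m.natAbs + a.natAbs) F := by
    refine ⟨fun x hx => hΦ x hx ▸ (Φ ⟨x, hx⟩).2, fun x _ y _ s t hxy => ?_⟩
    refine congrArg f (funext fun j => hxy _ ?_)
    have := j.2.1
    have := j.2.2
    exact abs_le.2 ⟨by omega, by omega⟩
  have hFinj : ∀ x ∈ X.carrier, ∀ y ∈ X.carrier, F x = F y → x = y := fun x hx y hy hxy => by
    rw [hΦ x hx, hΦ y hy] at hxy
    exact congrArg Subtype.val (hinj (Subtype.ext hxy))
  have hFsurj : ∀ w ∈ W.carrier, ∃ x ∈ X.carrier, F x = w := fun w hw => by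
    obtain ⟨⟨x, hx⟩, h⟩ := hsurj ⟨w, hw⟩
    exact ⟨x, hx, by rw [hΦ x hx, h]⟩
  obtain ⟨n, hn⟩ := exists_radius_inverse hF hFinj
  have : Nonempty (ℤ → A) := ⟨hne.some⟩
  classical
  set G : (ℤ → B) → ℤ → A := Function.invFunOn F X.carrier
  have hG : ∀ w ∈ W.carrier, G w ∈ X.carrier ∧ F (G w) = w := fun w hw =>
    Function.invFunOn_pos (hFsurj w hw)
  refine ⟨max (m.natAbs + a.natAbs) n, F, G, hF.mono (le_max_left _ _),
    IsLocalMap.mono ⟨fun w hw => (hG w hw).1, fun v hv w hw s t hvw => ?_⟩ (le_max_right _ _),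
    fun x hx => hFinj _ (hG _ (hF.maps x hx)).1 _ hx (hG _ (hF.maps x hx)).2,
    fun w hw => (hG w hw).2⟩
  have := hn (shift s (G v)) (X.shift_mem (hG v hv).1 s) (shift t (G w))
    (X.shift_mem (hG w hw).1 t) fun j hj => by
      rw [hF.shift (hG v hv).1, hF.shift (hG w hw).1, (hG v hv).2, (hG w hw).2]
      exact hvw j hj
  simpa [shift] using this

/-- Append `r` to the past of `F x`, pull back by `G`, move the resulting future from `x` to `y`,
and apply `F` again. Near the seam `F` sees up to `2 * k` symbols on either side, hence the window
of agreement. -/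
lemma IsConjugacy.followers_subset (h : X.IsConjugacy W k F G) {x y : ℤ → A}
    (hx : x ∈ X.carrier) (hy : y ∈ X.carrier) {s t : ℤ} (hst : X.followers x s = X.followers y t)
    (hxy : ∀ j : ℤ, -(2 * k) ≤ j → j < 2 * k → x (s + j) = y (t + j)) :
    W.followers (F x) (s + k) ⊆ W.followers (F y) (t + k) := by
  intro r hr
  set v := splice (F x) (s + k) r
  have hv : v ∈ W.carrier := hr
  have hGv : G v ∈ X.carrier := h.bwd.maps v hv
  have hGvx : ∀ j < s, G v j = x j := fun j hj => by
    have := h.bwd.eq_of_agree_lt hv (h.fwd.maps x hx) (t := s + k) (j := j)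
      (fun i hi => splice_of_lt hi) (by omega)
    rw [this, h.left_inv x hx]
  have hmem : tail (G v) s ∈ X.followers y t := by
    rw [← hst, ← followers_congr hGvx]
    exact tail_mem_followers hGv s
  set z := splice y t (tail (G v) s)
  have hz : z ∈ X.carrier := hmem
  have hz₁ : ∀ i < t, z i = y i := fun i hi => splice_of_lt hi
  have hz₂ : ∀ i ≥ t, z i = G v (s + (i - t)) := fun i hi => splice_tail_of_le hi
  have hFz : F z = splice (F y) (t + k) r := by
    have hge : ∀ j : ℤ, -k ≤ j → F z (t + j) = v (s + j) := fun j hj => by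
      conv_rhs => rw [← h.right_inv v hv]
      refine h.fwd.eq_of_agree hz hGv fun i hi _ => ?_
      rcases lt_or_ge (j + i) 0 with hneg | hpos
      · rw [hGvx _ (by omega), hz₁ _ (by omega), add_assoc, add_assoc,
          hxy _ (by omega) (by omega)]
      · rw [hz₂ _ (by omega)]
        congr 1
        omega
    funext j
    rcases lt_or_ge j (t + k) with hj | hj
    · rw [splice_of_lt hj]
      rcases lt_or_ge j (t - k) with hj' | hj'
      · exact h.fwd.eq_of_agree_lt hz hy hz₁ (by omega)
      · have := hge (j - t) (by omega)
        rw [show t + (j - t) = j by omega] at this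
        rw [this, show v (s + (j - t)) = F x (s + (j - t)) from splice_of_lt (by omega)]
        refine h.fwd.eq_of_agree hx hy fun i _ _ => ?_
        rw [add_assoc, hxy _ (by omega) (by omega)]
        congr 1
        omega
    · have := hge (j - t) (by omega)
      rw [show t + (j - t) = j by omega] at this
      rw [this, splice_of_le hj, show v (s + (j - t)) = _ from splice_of_le (by omega)]
      congr 1
      omega
  rw [mem_followers, ← hFz]
  exact h.fwd.maps z hz

/-- The follower sets of the image are determined by the follower sets and finitely many
symbols of the preimage. -/
lemma IsConjugacy.followers_eq (h : X.IsConjugacy W k F G) {x y : ℤ → A}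
    (hx : x ∈ X.carrier) (hy : y ∈ X.carrier) {s t : ℤ} (hst : X.followers x s = X.followers y t)
    (hxy : ∀ j : ℤ, 0 ≤ j → j < 4 * k → x (s + j) = y (t + j)) :
    W.followers (F x) (s + 3 * k) = W.followers (F y) (t + 3 * k) := by
  -- Advancing by `2 * k` turns agreement after `s`, `t` into the two-sided agreement needed by
  -- `followers_subset`.
  have h2 : X.followers x (s + 2 * k) = X.followers y (t + 2 * k) := by
    have := followers_add_eq hst (2 * k) fun i hi => hxy i (by omega) (by omega)
    push_cast at this
    exact this
  have hxy' : ∀ j : ℤ, -(2 * k) ≤ j → j < 2 * k →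
      x (s + 2 * k + j) = y (t + 2 * k + j) := fun j hj hj' => by
    rw [add_assoc, add_assoc, hxy _ (by omega) (by omega)]
  have e : ∀ a : ℤ, a + 3 * k = a + 2 * k + k := fun a => by ring
  rw [e, e]
  exact (h.followers_subset hx hy h2 hxy').antisymm
    (h.followers_subset hy hx h2.symm fun j hj hj' => (hxy' j hj hj').symm)

end SymbolicDynamics.FullShift.Subshift

/-! ### Shortest paths between follower sets -/

namespace SymbolicDynamics.FullShift.Subshift

variable {A B C : Type*} [TopologicalSpace A] [TopologicalSpace B] [TopologicalSpace C]

/-- The word `x[i, j - 1]` labels a shortest path from the follower set of `x[-∞, i - 1]` to that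
of `x[-∞, j - 1]`, the empty path being admitted. -/
def IsShortest (X : Subshift A ℤ) (x : ℤ → A) (i j : ℤ) : Prop :=
  ∀ y ∈ X.carrier, ∀ n : ℕ, (∀ t < i, y t = x t) → X.followers y (i + n) = X.followers x j →
    j - i ≤ n

/-- All words of `x[i₀, ∞]` label shortest paths between follower sets. -/
def IsShortestFrom (X : Subshift A ℤ) (x : ℤ → A) (i₀ : ℤ) : Prop :=
  ∀ i ≥ i₀, ∀ j ≥ i, X.IsShortest x i j

/-- The follower sets that are reached after following `x[-∞, T - 1]` by finite words. -/
def reachable (X : Subshift A ℤ) (x : ℤ → A) (T : ℤ) : Set (Set (ℕ → A)) :=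
  {S | ∃ y ∈ X.carrier, (∀ t < T, y t = x t) ∧ ∃ n : ℕ, X.followers y (T + n) = S}

/-- A shortcut for `G w`, continued by the future of `G w`, maps under `F` to a shortcut for `w`.
Both lengths grow by the same `4 * k`, so geodesics are preserved exactly and not merely up to a
constant. -/
lemma IsShortestFrom.image {X : Subshift A ℤ} {W : Subshift B ℤ} {k : ℕ} {F : (ℤ → A) → ℤ → B}
    {G : (ℤ → B) → ℤ → A} (h : X.IsConjugacy W k F G) {w : ℤ → B} (hw : w ∈ W.carrier) {i₀ : ℤ}
    (hs : W.IsShortestFrom w i₀) : X.IsShortestFrom (G w) (i₀ + k) := by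
  intro i hi j hj y hy n hyx hfol
  have hx : G w ∈ X.carrier := h.bwd.maps w hw
  have hz : splice y (i + n) (tail (G w) j) ∈ X.carrier := splice_tail_mem hfol hx
  set z := splice y (i + n) (tail (G w) j)
  have hzfol : X.followers z (i + n) = X.followers (G w) j := by
    rw [← hfol]
    exact followers_splice _ _ _
  have key := h.followers_eq hz hx hzfol fun l hl _ => by
    have : z (i + n + l) = G w (j + (i + n + l - (i + n))) := splice_tail_of_le (by omega)
    rw [this]
    congr 1
    omega
  rw [h.right_inv w hw] at key
  -- The image agrees with `w` only before `i - k`, and the follower sets meet only `3 * k` after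
  -- the seam.
  have := hs (i - k) (by omega) (j + 3 * k) (by omega) (F z) (h.fwd.maps z hz) (n + 4 * k)
    (fun t ht => by
      conv_rhs => rw [← h.right_inv w hw]
      refine h.fwd.eq_of_agree_lt hz hx (t := i) (fun l hl => ?_) (by omega)
      rw [← hyx l hl]
      exact splice_of_lt (by omega)) (by
      rw [← key]
      congr 1
      push_cast
      ring)
  push_cast at this
  omega

lemma IsShortest.congr {X : Subshift A ℤ} {x y : ℤ → A} {i j : ℤ} (h : X.IsShortest x i j)
    (hij : i ≤ j) (hxy : ∀ t < j, x t = y t) : X.IsShortest y i j := by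
  intro z hz n hzy hfol
  refine h z hz n (fun t ht => ?_) ?_
  · rw [hzy t ht, hxy t (by omega)]
  · rw [hfol, followers_congr hxy]

/-- A shortcut to `l` followed by `x[l, j - 1]` is a shortcut to `j`. -/
lemma IsShortest.mono_right {X : Subshift A ℤ} {x : ℤ → A} (hx : x ∈ X.carrier) {i j l : ℤ}
    (h : X.IsShortest x i j) (hlj : l ≤ j) : X.IsShortest x i l := by
  intro y hy n hyx hfol
  have hz := splice_tail_mem hfol hx
  have hzfol := followers_splice (X := X) y (i + n) (tail x l)
  have key := followers_add_eq (hzfol.trans hfol) (j - l).toNat fun m _ => splice_add_nat _ _ _ m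
  have := h _ hz (n + (j - l).toNat) (fun t ht => by
    rw [splice_of_lt (by omega), hyx t ht]) (by
    rw [show l + ((j - l).toNat : ℤ) = j by omega] at key
    rw [← key]
    congr 1
    push_cast
    ring)
  push_cast at this
  omega

lemma IsShortest.mono_left {X : Subshift A ℤ} {x : ℤ → A} {i j l : ℤ}
    (h : X.IsShortest x i j) (hl : i ≤ l) : X.IsShortest x l j := by
  intro y hy n hyx hfol
  have := h y hy ((l - i).toNat + n) (fun t ht => hyx t (by omega)) (by
    rw [← hfol]
    congr 1
    push_cast
    omega)
  push_cast at this
  omega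

lemma finite_of_relation {α β : Type*} {S : Set α} {T : Set β} (hT : T.Finite)
    (R : α → β → Prop) (h₁ : ∀ a ∈ S, ∃ b ∈ T, R a b)
    (h₂ : ∀ a a' b, R a b → R a' b → a = a') : S.Finite := by
  have := hT.to_subtype
  choose f hf hR using h₁
  exact Set.finite_coe_iff.1 (Finite.of_injective (fun a : S => (⟨f a a.2, hf a a.2⟩ : T))
    fun a b hab => Subtype.ext (h₂ _ _ _ (hR a a.2) (by
      rw [show f a a.2 = f b b.2 from congrArg Subtype.val hab]
      exact hR b b.2)))

/-- If infinitely many follower sets are reachable, then there are arbitrarily long shortest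
paths. -/
lemma exists_isShortest_of_infinite [Finite A] {X : Subshift A ℤ} {x : ℤ → A} {T : ℤ}
    (hinf : (X.reachable x T).Infinite) (N : ℕ) :
    ∃ y ∈ X.carrier, (∀ t < T, y t = x t) ∧ X.IsShortest y T (T + N) := by
  by_contra! hcon
  -- Without shortest paths of length `N`, repeated shortening reaches every follower set in fewer
  -- than `N` steps, and there are finitely many words of such lengths.
  have hred : ∀ n : ℕ, ∀ y ∈ X.carrier, (∀ t < T, y t = x t) → ∃ z ∈ X.carrier,
      (∀ t < T, z t = x t) ∧ ∃ m < N, X.followers z (T + (m : ℕ)) = X.followers y (T + n) := by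
    intro n
    induction n using Nat.strong_induction_on with
    | _ n ih =>
      intro y hy hyx
      rcases lt_or_ge n N with hn | hn
      · exact ⟨y, hy, hyx, n, hn, rfl⟩
      · have hns : ¬ X.IsShortest y T (T + n) := fun h =>
          hcon y hy hyx (h.mono_right hy (by omega))
        simp only [IsShortest, not_forall, not_le] at hns
        obtain ⟨z, hz, m, hzy, hfol, hm⟩ := hns
        obtain ⟨z', h₁, h₂, m', h₃, h₄⟩ := ih m (by omega) z hz fun t ht => by
          rw [hzy t ht, hyx t ht]
        exact ⟨z', h₁, h₂, m', h₃, h₄.trans hfol⟩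
  refine hinf ?_
  refine finite_of_relation (T := (Set.univ : Set (Fin N × (Fin N → A)))) Set.finite_univ
    (fun S b => ∃ y ∈ X.carrier, (∀ t < T, y t = x t) ∧ (∀ i : Fin N, y (T + (i : ℕ)) = b.2 i) ∧
      S = X.followers y (T + (b.1 : ℕ))) ?_ ?_
  · rintro S ⟨y, hy, hyx, n, rfl⟩
    obtain ⟨z, hz, hzx, m, hm, hfol⟩ := hred n y hy hyx
    exact ⟨(⟨m, hm⟩, fun i => z (T + (i : ℕ))), trivial, z, hz, hzx, fun _ => rfl, hfol.symm⟩
  · rintro S S' ⟨m, b⟩ ⟨y, -, hyx, hyb, rfl⟩ ⟨z, -, hzx, hzb, rfl⟩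
    refine followers_add_eq (followers_congr fun t ht => ?_) m fun i hi => ?_
    · rw [hyx t ht, hzx t ht]
    · exact (hyb ⟨i, by omega⟩).trans (hzb ⟨i, by omega⟩).symm

/-- Kőnig's lemma for shortest paths. -/
lemma exists_isShortestFrom [Finite A] {X : Subshift A ℤ} {x : ℤ → A} {T : ℤ}
    (hinf : (X.reachable x T).Infinite) :
    ∃ y ∈ X.carrier, (∀ t < T, y t = x t) ∧ X.IsShortestFrom y T := by
  choose p hp hpx hps using exists_isShortest_of_infinite hinf
  obtain ⟨q, hq⟩ := exists_limit_config p
  have hqX : q ∈ X.carrier := mem_of_approx X fun N => by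
    obtain ⟨n, -, h⟩ := hq N 0
    exact ⟨p n, hp n, h⟩
  have hqx : ∀ t < T, q t = x t := fun t ht => by
    obtain ⟨n, -, h⟩ := hq t.natAbs 0
    rw [← h t (abs_le.2 ⟨by omega, by omega⟩), hpx n t ht]
  refine ⟨q, hqX, hqx, fun i hi j hj => ?_⟩
  refine IsShortest.mono_left (i := T) ?_ hi
  obtain ⟨n, hn, h⟩ := hq (j.natAbs + T.natAbs) (j - T).toNat
  refine ((hps n).mono_right (hp n) (l := j) (by omega)).congr (by omega)
    fun t ht => ?_
  rcases lt_or_ge t T with htT | htT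
  · rw [hpx n t htT, hqx t htT]
  · exact h t (abs_le.2 ⟨by omega, by omega⟩)

/-! ### Products -/

variable {Y : Subshift B ℤ} {Z : Subshift C ℤ}

lemma mem_followers_prod {w : ℤ → B × C} {i : ℤ} {r : ℕ → B × C} :
    r ∈ (Y.prod Z).followers w i ↔ (fun n => (r n).1) ∈ Y.followers (fun j => (w j).1) i ∧
      (fun n => (r n).2) ∈ Z.followers (fun j => (w j).2) i := by
  have h₁ : (fun j => (splice w i r j).1) = splice (fun j => (w j).1) i fun n => (r n).1 :=
    funext fun j => by simp only [splice]; split_ifs <;> rfl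
  have h₂ : (fun j => (splice w i r j).2) = splice (fun j => (w j).2) i fun n => (r n).2 :=
    funext fun j => by simp only [splice]; split_ifs <;> rfl
  rw [mem_followers, mem_followers, mem_followers, ← h₁, ← h₂]
  rfl

/-- Each factor can be recovered from the product because neither follower set is empty: each
contains the actual future. -/
lemma followers_prod_eq_iff {v w : ℤ → B × C} (hv : v ∈ (Y.prod Z).carrier)
    (hw : w ∈ (Y.prod Z).carrier) {i j : ℤ} :
    (Y.prod Z).followers v i = (Y.prod Z).followers w j ↔
      Y.followers (fun t => (v t).1) i = Y.followers (fun t => (w t).1) j ∧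
        Z.followers (fun t => (v t).2) i = Z.followers (fun t => (w t).2) j := by
  constructor
  · intro h
    have key : ∀ (r : ℕ → B) (s : ℕ → C), (r ∈ Y.followers (fun t => (v t).1) i ∧
        s ∈ Z.followers (fun t => (v t).2) i) ↔ (r ∈ Y.followers (fun t => (w t).1) j ∧
        s ∈ Z.followers (fun t => (w t).2) j) := fun r s => by
      have := Set.ext_iff.1 h fun n => (r n, s n)
      rwa [mem_followers_prod, mem_followers_prod] at this
    have hv₁ := tail_mem_followers hv.1 i
    have hv₂ := tail_mem_followers hv.2 i
    have hw₁ := tail_mem_followers hw.1 j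
    have hw₂ := tail_mem_followers hw.2 j
    have hv₂' := ((key _ _).1 ⟨hv₁, hv₂⟩).2
    have hv₁' := ((key _ _).1 ⟨hv₁, hv₂⟩).1
    have hw₂' := ((key _ _).2 ⟨hw₁, hw₂⟩).2
    have hw₁' := ((key _ _).2 ⟨hw₁, hw₂⟩).1
    exact ⟨Set.ext fun r => ⟨fun hr => ((key r _).1 ⟨hr, hv₂⟩).1,
      fun hr => ((key r _).2 ⟨hr, hw₂⟩).1⟩, Set.ext fun s => ⟨fun hs => ((key _ s).1 ⟨hv₁, hs⟩).2,
      fun hs => ((key _ s).2 ⟨hw₁, hs⟩).2⟩⟩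
  · rintro ⟨h₁, h₂⟩
    ext r
    rw [mem_followers_prod, mem_followers_prod, h₁, h₂]

lemma IsShortestFrom.prod {p : ℤ → B} {q : ℤ → C} {i₀ : ℤ} (hp : p ∈ Y.carrier)
    (hq : q ∈ Z.carrier) (h : Y.IsShortestFrom p i₀) :
    (Y.prod Z).IsShortestFrom (fun i => (p i, q i)) i₀ := by
  intro i hi j hj w hw n hwp hfol
  have hpq : (fun i => (p i, q i)) ∈ (Y.prod Z).carrier := ⟨hp, hq⟩
  exact h i hi j hj _ hw.1 n (fun t ht => by rw [hwp t ht])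
    ((followers_prod_eq_iff hw hpq).1 hfol).1

lemma reachable_prod_infinite {w : ℤ → B × C} {T : ℤ}
    (h : ((Y.prod Z).reachable w T).Infinite) :
    (Y.reachable (fun i => (w i).1) T).Infinite ∨ (Z.reachable (fun i => (w i).2) T).Infinite := by
  by_contra! hcon
  refine h ?_
  refine (hcon.1.image2 (fun S S' => {r : ℕ → B × C | (fun n => (r n).1) ∈ S ∧
    (fun n => (r n).2) ∈ S'}) hcon.2).subset ?_
  rintro _ ⟨y, hy, hyw, n, rfl⟩
  refine ⟨_, ⟨_, hy.1, fun t ht => by rw [hyw t ht], n, rfl⟩, _,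
    ⟨_, hy.2, fun t ht => by rw [hyw t ht], n, rfl⟩, ?_⟩
  ext r
  exact mem_followers_prod.symm

end SymbolicDynamics.FullShift.Subshift

/-! ### Half-synchronizing pasts, recurrence and soficity -/

namespace SymbolicDynamics.FullShift.Subshift

variable {A B C : Type*} [TopologicalSpace A] [TopologicalSpace B] [TopologicalSpace C]

/-- The word `x₀[-L, -1]` is half-synchronizing, as witnessed by `x₀[-∞, -1]`, and may be followed
by every word of `X`. -/
structure IsHalfSyncConfig (X : Subshift A ℤ) (x₀ : ℤ → A) (L : ℕ) : Prop where
  mem : x₀ ∈ X.carrier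
  tail_mem : ∀ z ∈ X.carrier, (∀ j : ℤ, -L ≤ j → j < 0 → z j = x₀ j) →
    tail z 0 ∈ X.followers x₀ 0
  occurs_before : ∀ x ∈ X.carrier, ∀ (i : ℤ) (n : ℕ), ∃ m : ℕ, ∀ j : ℤ, 0 ≤ j → j < n →
    x₀ (-(m + n) + j) = x (i + j)
  occurs_after : ∀ x ∈ X.carrier, ∀ (i : ℤ) (n : ℕ), ∃ z ∈ X.carrier,
    (∀ j : ℤ, -L ≤ j → j < 0 → z j = x₀ j) ∧ ∃ m : ℕ, ∀ j : ℤ, 0 ≤ j → j < n →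
      z (m + j) = x (i + j)

/-- The follower set of `x₀[-∞, T - 1]` is recurrent, and may be followed by every word of `X`. -/
structure IsRecurrentAt (X : Subshift A ℤ) (x₀ : ℤ → A) (T : ℤ) : Prop where
  mem : x₀ ∈ X.carrier
  exists_return : ∀ x ∈ X.carrier, (∀ t < T, x t = x₀ t) → ∀ N : ℕ, ∃ y ∈ X.carrier,
    (∀ t < T + N, y t = x t) ∧ ∃ M : ℕ, N ≤ M ∧ X.followers y (T + M) = X.followers x₀ T
  occurs_after : ∀ x ∈ X.carrier, ∀ (i : ℤ) (n : ℕ), ∃ y ∈ X.carrier,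
    (∀ t < T, y t = x₀ t) ∧ ∃ m : ℕ, ∀ j : ℤ, 0 ≤ j → j < n → y (T + m + j) = x (i + j)

variable {X : Subshift A ℤ} {x₀ : ℤ → A} {L : ℕ}

/-- The past of `x₀` contains every word, in particular the half-synchronizing word followed by
`x[0, N - 1]`. Continuing `x` from such an occurrence up to the end of that past leads back to the
base vertex. -/
lemma IsHalfSyncConfig.exists_return (h : X.IsHalfSyncConfig x₀ L) {x : ℤ → A}
    (hx : x ∈ X.carrier) (hxx : ∀ t < 0, x t = x₀ t) (N : ℕ) :
    ∃ y ∈ X.carrier, (∀ t : ℤ, t < N → y t = x t) ∧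
      ∃ M : ℕ, N ≤ M ∧ X.followers y M = X.followers x₀ 0 := by
  obtain ⟨m, hm⟩ := h.occurs_before x hx (-L) (L + N)
  set M : ℕ := N + m
  have hM : ∀ j : ℤ, -L ≤ j → j < N → x₀ (-M + j) = x j := fun j h₁ h₂ => by
    have := hm (j + L) (by omega) (by push_cast; omega)
    rw [show -(L : ℤ) + (j + L) = j by ring] at this
    rw [← this]
    congr 1
    simp only [M]
    push_cast
    ring
  have key : ∀ z ∈ X.carrier, (∀ j : ℤ, -L ≤ j → j < 0 → z j = x₀ (-M + j)) →
      tail z 0 ∈ X.followers x 0 := fun z hz hzx => by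
    rw [followers_congr hxx]
    refine h.tail_mem z hz fun j h₁ h₂ => ?_
    rw [hzx j h₁ h₂, hM j h₁ (by omega), hxx j h₂]
  have hy : splice x 0 (tail (shift (-M : ℤ) x₀) 0) ∈ X.carrier :=
    key _ (X.shift_mem h.mem _) fun j _ _ => rfl
  set y := splice x 0 (tail (shift (-M : ℤ) x₀) 0)
  have hy₁ : ∀ t < 0, y t = x t := fun t ht => splice_of_lt ht
  have hy₂ : ∀ t : ℤ, -L ≤ t → y t = x₀ (-M + t) := fun t ht => by
    rcases lt_or_ge t 0 with h0 | h0
    · rw [hy₁ t h0, hM t ht (by omega)]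
    · rw [show y t = shift (-M : ℤ) x₀ (0 + (t - 0)) from splice_tail_of_le h0, shift]
      congr 1
      ring
  refine ⟨y, hy, fun t ht => ?_, M, by omega, Set.ext fun r => ⟨fun hr => ?_, fun hr => ?_⟩⟩
  · rcases lt_or_ge t 0 with h0 | h0
    · exact hy₁ t h0
    · rw [hy₂ t (by omega), hM t (by omega) ht]
  -- The past of `y` at `M` ends with the half-synchronizing word, which gives one inclusion.
  · have := h.tail_mem _ (X.shift_mem (mem_followers.1 hr) M) fun j h₁ h₂ => by
      rw [shift, splice_of_lt (by omega), hy₂ _ (by omega)]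
      congr 1
      ring
    convert this using 1
    funext n
    simp only [tail, shift, zero_add, splice_add_nat]
  -- In `x₀` the word `x₀[-M, -1]` is itself preceded by the half-synchronizing word, so `x₀[-M, -1]
  -- r` may follow the past of `x`.
  · have := key _ (X.shift_mem (mem_followers.1 hr) (-M)) fun j h₁ h₂ => by
      rw [shift, splice_of_lt (by omega)]
    rw [mem_followers] at this ⊢
    convert this using 1
    funext j
    rcases lt_or_ge j 0 with h0 | h0
    · rw [splice_of_lt (by omega), splice_of_lt h0, hy₁ j h0]
    · rw [splice_tail_of_le h0, shift]
      rcases lt_or_ge j M with h1 | h1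
      · rw [splice_of_lt h1, splice_of_lt (by omega), hy₂ j (by omega)]
        congr 1
        ring
      · rw [splice_of_le h1, splice_of_le (by omega)]
        congr 1
        omega

lemma IsHalfSyncConfig.exists_occurrence (h : X.IsHalfSyncConfig x₀ L) {x : ℤ → A}
    (hx : x ∈ X.carrier) (i : ℤ) (n N : ℕ) :
    ∃ y ∈ X.carrier, (∀ t : ℤ, t < N → y t = x₀ t) ∧
      ∃ m : ℕ, N ≤ m ∧ ∀ j : ℤ, 0 ≤ j → j < n → y (m + j) = x (i + j) := by
  obtain ⟨y, hy, hyx, M, hM, hfol⟩ := h.exists_return h.mem (fun _ _ => rfl) N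
  obtain ⟨z, hz, hzx, m, hm⟩ := h.occurs_after x hx i n
  have hmem := h.tail_mem z hz hzx
  rw [← hfol] at hmem
  refine ⟨_, hmem, fun t ht => ?_, M + m, by omega, fun j h₁ h₂ => ?_⟩
  · rw [splice_of_lt (by omega), hyx t ht]
  · rw [splice_tail_of_le (by push_cast; omega), ← hm j h₁ h₂]
    congr 1
    push_cast
    ring

/-- Follow `x₀` up to `N`, return to the base vertex, and only then take the given path. -/
lemma IsHalfSyncConfig.reachable_subset (h : X.IsHalfSyncConfig x₀ L) (N : ℕ) :
    X.reachable x₀ 0 ⊆ X.reachable x₀ N := by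
  rintro _ ⟨x, hx, hxx, n, rfl⟩
  obtain ⟨y, hy, hyx, M, hM, hfol⟩ := h.exists_return h.mem (fun _ _ => rfl) N
  rw [← followers_congr hxx] at hfol
  refine ⟨_, splice_tail_mem hfol hx, fun t ht => ?_, M - N + n, ?_⟩
  · rw [splice_of_lt (by omega), hyx t ht]
  · have := followers_add_eq ((followers_splice y M (tail x 0)).trans hfol) n
      fun i _ => splice_add_nat _ _ _ i
    rw [← this]
    congr 1
    push_cast [hM]
    ring

/-- If a half-synchronizing word has finitely many reachable follower sets, then the subshift
is sofic. -/
lemma IsHalfSyncConfig.isSofic (h : X.IsHalfSyncConfig x₀ L) (hfin : (X.reachable x₀ 0).Finite) :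
    X.IsSofic := by
  refine (hfin.powerset.image Set.sUnion).subset ?_
  rintro _ ⟨_, ⟨x, hx, rfl⟩, rfl⟩
  set R : Set (ℕ → A) → ℕ → Prop := fun S N => ∃ y ∈ X.carrier, (∀ t < 0, y t = x₀ t) ∧
    ∃ m : ℕ, X.followers y m = S ∧ ∀ j : ℤ, -N ≤ j → j < 0 → y (m + j) = x j
  -- The follower set of `x[-∞, -1]` is the union of the reachable sets that occur after `x[-N, -1]`
  -- for every `N`. Only finitely many such unions exist.
  refine ⟨{S ∈ X.reachable x₀ 0 | ∀ N, R S N}, fun S hS => hS.1, ?_⟩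
  rw [rayFollower_leftRay]
  ext r
  constructor
  · rintro ⟨S, ⟨-, hS⟩, hr⟩
    refine mem_of_approx X fun N => ?_
    obtain ⟨y, hy, -, m, rfl, hyx⟩ := hS N
    refine ⟨_, X.shift_mem hr m, fun j hj => ?_⟩
    rw [abs_le] at hj
    rw [shift]
    rcases lt_or_ge j 0 with h0 | h0
    · rw [splice_of_lt (by omega), splice_of_lt h0, hyx j hj.1 h0]
    · rw [splice_of_le (by omega), splice_of_le h0]
      congr 1
      omega
  · intro hr
    have hocc := fun N : ℕ => h.exists_occurrence (mem_followers.1 hr) (-N) (2 * N) N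
    choose y hy hyx m hm hym using hocc
    have hyx' : ∀ N, ∀ t < 0, y N t = x₀ t := fun N t ht => hyx N t (by omega)
    have hwin : ∀ N : ℕ, ∀ j : ℤ, -N ≤ j → j < N →
        y N ((m N + N : ℕ) + j) = splice x 0 r j := fun N j h₁ h₂ => by
      have := hym N (j + N) (by omega) (by push_cast; omega)
      rw [show -(N : ℤ) + (j + N) = j by ring] at this
      rw [← this]
      congr 1
      push_cast
      ring
    have := hfin.to_subtype
    -- By pigeonhole one reachable set serves infinitely many `N`, hence all `N`. It contains `r`
    -- because follower sets are closed.
    obtain ⟨⟨S, hS⟩, hinf⟩ := Finite.exists_infinite_fiber fun N =>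
      (⟨X.followers (y N) (m N + N : ℕ), y N, hy N, hyx' N, m N + N, by rw [zero_add]⟩ :
        X.reachable x₀ 0)
    rw [Set.infinite_coe_iff] at hinf
    have hlarge : ∀ N₀ : ℕ, ∃ N ≥ N₀, X.followers (y N) (m N + N : ℕ) = S := fun N₀ => by
      obtain ⟨N, hN, hlt⟩ := hinf.exists_gt N₀
      exact ⟨N, hlt.le, congrArg Subtype.val hN⟩
    refine ⟨S, ⟨hS, fun N₀ => ?_⟩, ?_⟩
    · obtain ⟨N, hN, hNS⟩ := hlarge N₀
      refine ⟨y N, hy N, hyx' N, m N + N, hNS, fun j h₁ h₂ => ?_⟩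
      rw [hwin N j (by omega) (by omega), splice_of_lt h₂]
    · obtain ⟨N₁, -, hN₁⟩ := hlarge 0
      rw [← hN₁]
      refine mem_followers_of_approx fun N₀ => ?_
      obtain ⟨N, hN, hNS⟩ := hlarge N₀
      rw [hN₁, ← hNS]
      refine ⟨_, tail_mem_followers (hy N) _, fun n hn => ?_⟩
      rw [tail, hwin N n (by omega) (by omega), splice_of_le (by omega)]
      congr 1

variable {W : Subshift B ℤ} {k : ℕ} {F : (ℤ → A) → ℤ → B} {G : (ℤ → B) → ℤ → A}

/-- Recurrence replaces half-synchronization from here on: it passes through conjugacies, at the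
cost of the delay `3 * k` from `followers_eq`, and to factors of a product. -/
lemma IsHalfSyncConfig.isRecurrentAt (h : X.IsHalfSyncConfig x₀ L) (hc : X.IsConjugacy W k F G) :
    W.IsRecurrentAt (F x₀) (3 * k) := by
  refine ⟨hc.fwd.maps _ h.mem, fun w hw hww N => ?_, fun w hw i n => ?_⟩
  · have hGw := hc.bwd.maps w hw
    obtain ⟨x, hx, hxw, M, hM, hfol⟩ := h.exists_return hGw (fun t ht => by
      conv_rhs => rw [← hc.left_inv x₀ h.mem]
      exact hc.bwd.eq_of_agree_lt hw (hc.fwd.maps _ h.mem) hww (by omega)) (3 * k + N + k)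
    -- After the return the future of `x₀` itself is followed, so that the `4 * k` symbols required
    -- by `followers_eq` match.
    have hy := splice_tail_mem hfol h.mem
    refine ⟨_, hc.fwd.maps _ hy, fun t ht => ?_, M, by omega, ?_⟩
    · conv_rhs => rw [← hc.right_inv w hw]
      refine hc.fwd.eq_of_agree_lt hy hGw (t := 3 * k + N + k) (fun j hj => ?_) (by omega)
      rw [splice_of_lt (by omega), hxw j (by push_cast; omega)]
    · have := hc.followers_eq hy h.mem ((followers_splice _ _ _).trans hfol) fun j h₁ _ => by
        rw [splice_tail_of_le (by omega)]
        congr 1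
        ring
      rw [zero_add] at this
      rw [← this, add_comm]
  · have hGw := hc.bwd.maps w hw
    obtain ⟨y, hy, hyx, m, hm, hym⟩ := h.exists_occurrence hGw (i - k) (k + n + k) (3 * k + k)
    refine ⟨F y, hc.fwd.maps _ hy, fun t ht =>
      hc.fwd.eq_of_agree_lt hy h.mem hyx (by push_cast; omega), m + k - 3 * k, fun j h₁ h₂ => ?_⟩
    conv_rhs => rw [← hc.right_inv w hw]
    refine hc.fwd.eq_of_agree hy hGw fun l h₃ h₄ => ?_
    have := hym (k + j + l) (by omega) (by push_cast; omega)
    rw [show (i : ℤ) + j + l = i - k + (k + j + l) by ring, ← this]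
    congr 1
    omega

/-- Applied to the inverse conjugacy, `followers_eq` recovers a follower set of `X` from one of `W`
and `4 * k` symbols. The delays for `F` and `G` add up to `6 * k`. -/
lemma IsHalfSyncConfig.reachable_infinite [Finite B] (h : X.IsHalfSyncConfig x₀ L)
    (hc : X.IsConjugacy W k F G) (hinf : (X.reachable x₀ 0).Infinite) :
    (W.reachable (F x₀) (3 * k)).Infinite := by
  intro hfin
  refine hinf (Set.Finite.subset ?_ (h.reachable_subset (6 * k)))
  refine finite_of_relation (hfin.prod (Set.finite_univ (α := Fin (4 * k) → B)))
    (fun S b => ∃ w ∈ W.carrier, ∃ t : ℤ, W.followers w t = b.1 ∧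
      (∀ i : Fin (4 * k), w (t + (i : ℕ)) = b.2 i) ∧ S = X.followers (G w) (t + 3 * k)) ?_ ?_
  · rintro _ ⟨y, hy, hyx, n, rfl⟩
    have hFy := hc.fwd.maps y hy
    refine ⟨(W.followers (F y) (3 * k + n), fun i => F y (3 * k + n + (i : ℕ))),
      ⟨⟨F y, hFy, fun t ht => ?_, n, rfl⟩, trivial⟩, F y, hFy, _, rfl, fun _ => rfl, ?_⟩
    · exact hc.fwd.eq_of_agree_lt hy h.mem hyx (by push_cast; omega)
    · rw [hc.left_inv y hy]
      congr 1
      push_cast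
      ring
  · rintro _ _ b ⟨v, hv, s, hs, hvb, rfl⟩ ⟨w, hw, t, ht, hwb, rfl⟩
    refine hc.symm.followers_eq hv hw (hs.trans ht.symm) fun j h₁ h₂ => ?_
    have e₁ := hvb ⟨j.toNat, by omega⟩
    have e₂ := hwb ⟨j.toNat, by omega⟩
    simp only [Int.toNat_of_nonneg h₁] at e₁ e₂
    rw [e₁, e₂]

variable {Y : Subshift B ℤ} {Z : Subshift C ℤ}

lemma IsRecurrentAt.snd {w₀ : ℤ → B × C} {T : ℤ} (h : (Y.prod Z).IsRecurrentAt w₀ T) :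
    Z.IsRecurrentAt (fun i => (w₀ i).2) T := by
  refine ⟨h.mem.2, fun q hq hqw N => ?_, fun q hq i n => ?_⟩
  · obtain ⟨w, hw, hwq, M, hM, hfol⟩ := h.exists_return (fun i => ((w₀ i).1, q i)) ⟨h.mem.1, hq⟩
      (fun t ht => Prod.ext rfl (hqw t ht)) N
    exact ⟨_, hw.2, fun t ht => by rw [hwq t ht], M, hM, ((followers_prod_eq_iff hw h.mem).1 hfol).2⟩
  · obtain ⟨w, hw, hww, m, hm⟩ := h.occurs_after (fun i => ((w₀ i).1, q i)) ⟨h.mem.1, hq⟩ i n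
    exact ⟨_, hw.2, fun t ht => by rw [hww t ht], m, fun j h₁ h₂ => by rw [hm j h₁ h₂]⟩

end SymbolicDynamics.FullShift.Subshift

/-! ### Loops at a recurrent follower set -/

namespace SymbolicDynamics.FullShift

variable {A : Type*}

/-- Prepending the first `n` symbols of `a` preserves membership and nonmembership in `E`. -/
def IsLoop (E : Set (ℕ → A)) (a : ℕ → A) (n : ℕ) : Prop :=
  ∀ r, prependTake a n r ∈ E ↔ r ∈ E

/-- The concatenation of words of length `n`, the `m`-th of which is `b` if `f m` holds and `a`
otherwise. -/
def blocks (a b : ℕ → A) (n : ℕ) (f : ℕ → Bool) : ℕ → A :=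
  fun i => if f (i / n) then b (i % n) else a (i % n)

lemma blocks_add {a b : ℕ → A} {n : ℕ} {f : ℕ → Bool} {m i : ℕ} (hi : i < n) :
    blocks a b n f (n * m + i) = if f m then b i else a i := by
  rw [blocks, Nat.mul_add_mod, Nat.mod_eq_of_lt hi, Nat.mul_add_div (by omega),
    Nat.div_eq_of_lt hi, add_zero]

lemma IsLoop.blocks {E : Set (ℕ → A)} {a b : ℕ → A} {n : ℕ} (ha : IsLoop E a n)
    (hb : IsLoop E b n) (f : ℕ → Bool) (m : ℕ) : IsLoop E (blocks a b n f) (n * m) := by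
  induction m with
  | zero =>
    intro r
    rw [mul_zero, show prependTake (FullShift.blocks a b n f) 0 r = r from
      funext fun i => if_neg (Nat.not_lt_zero i)]
  | succ m ih =>
    intro r
    have : prependTake (FullShift.blocks a b n f) (n * (m + 1)) r =
        prependTake (FullShift.blocks a b n f) (n * m)
          (prependTake (if f m then b else a) n r) := by
      funext i
      simp only [prependTake, Nat.mul_add, mul_one]
      by_cases h₁ : i < n * m
      · rw [if_pos h₁, if_pos (by omega)]
      · rw [if_neg h₁]
        by_cases h₂ : i < n * m + n
        · have := blocks_add (a := a) (b := b) (f := f) (m := m)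
            (show i - n * m < n by omega)
          rw [show n * m + (i - n * m) = i by omega] at this
          rw [if_pos h₂, if_pos (by omega), this]
          split_ifs <;> rfl
        · rw [if_neg h₂, if_neg (by omega)]
          congr 1
          omega
    rw [this, ih]
    split_ifs
    · exact hb r
    · exact ha r

namespace Subshift

variable [TopologicalSpace A] {X : Subshift A ℤ} {x₀ : ℤ → A} {T : ℤ}

lemma blocks_mem_followers {a b : ℕ → A} {n : ℕ} (hn : 0 < n) (hx₀ : x₀ ∈ X.carrier)
    (ha : IsLoop (X.followers x₀ T) a n) (hb : IsLoop (X.followers x₀ T) b n) (f : ℕ → Bool) :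
    blocks a b n f ∈ X.followers x₀ T :=
  mem_followers_of_approx fun N =>
    ⟨_, (ha.blocks hb f N _).2 (tail_mem_followers hx₀ T), fun i hi => by
      rw [prependTake, if_pos (hi.trans_le (Nat.le_mul_of_pos_left N hn))]⟩

lemma followers_splice_loop {a : ℕ → A} {n : ℕ} (ha : IsLoop (X.followers x₀ T) a n) :
    X.followers (splice x₀ T a) (T + n) = X.followers x₀ T := by
  ext r
  rw [mem_followers_add, tail_splice, followers_splice]
  exact ha r

lemma IsRecurrentAt.exists_loop (h : X.IsRecurrentAt x₀ T) {r : ℕ → A}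
    (hr : r ∈ X.followers x₀ T) (N : ℕ) :
    ∃ M ≥ N, ∃ a, IsLoop (X.followers x₀ T) a M ∧ ∀ i < N, a i = r i := by
  obtain ⟨y, hy, hyr, M, hM, hfol⟩ := h.exists_return _ (mem_followers.1 hr)
    (fun t ht => splice_of_lt ht) N
  refine ⟨M, hM, tail y T, fun s => ?_, fun i hi => ?_⟩
  · have : X.followers x₀ T = X.followers y T :=
      followers_congr fun t ht => by rw [hyr t (by omega), splice_of_lt ht]
    rw [this, ← mem_followers_add, hfol, this]
  · rw [tail, hyr _ (by omega), splice_add_nat]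

/-- Either there are two distinct loops of the same length, or all loops are powers of a
single one. -/
lemma IsRecurrentAt.exists_loops_or_periodic (h : X.IsRecurrentAt x₀ T) :
    (∃ n a b, IsLoop (X.followers x₀ T) a n ∧ IsLoop (X.followers x₀ T) b n ∧
      ∃ i < n, a i ≠ b i) ∨
    ∃ n > 0, ∃ u : ℕ → A, ∀ r ∈ X.followers x₀ T, ∀ i, r i = u (i % n) := by
  refine or_iff_not_imp_left.2 fun hcon => ?_
  obtain ⟨n, hn, u, hu, -⟩ := h.exists_loop (tail_mem_followers h.mem T) 1
  refine ⟨n, hn, u, fun r hr i => ?_⟩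
  obtain ⟨m, hm, v, hv, hvr⟩ := h.exists_loop hr (i + 1)
  by_contra hne
  -- The powers `u ^ m` and `v ^ n` are loops of the same length, hence equal, so `v` is a prefix of
  -- `u u u ⋯`.
  refine hcon ⟨n * m, blocks u u n fun _ => false, blocks v v m fun _ => false,
    hu.blocks hu _ m, mul_comm n m ▸ hv.blocks hv _ n, i,
    lt_of_lt_of_le (by omega) (Nat.le_mul_of_pos_left m hn), fun heq => hne ?_⟩
  simp only [blocks, Nat.mod_eq_of_lt (show i < m by omega)] at heq
  rw [← hvr i (by omega)]
  simpa using heq.symm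

/-- Every word of `X` occurs in the periodic sequence with period `u`. Long constant words from the
fixed point force `u`, and then everything, to be constant. -/
lemma IsRecurrentAt.isTrivial_of_periodic (h : X.IsRecurrentAt x₀ T) (hfix : X.HasFixedPoint)
    {n : ℕ} (hn : 0 < n) {u : ℕ → A} (hu : ∀ r ∈ X.followers x₀ T, ∀ i, r i = u (i % n)) :
    X.IsTrivial := by
  obtain ⟨c, hc, hcfix⟩ := hfix
  have hc' : ∀ i, c i = c 0 := fun i => by
    induction i with
    | zero => rfl
    | succ i ih => rw [hcfix, ih]
    | pred i ih => rw [← ih, ← hcfix (-i - 1), sub_add_cancel]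
  have key : ∀ z ∈ X.carrier, ∀ (i : ℤ) (l : ℕ), ∃ m : ℕ, ∀ j : ℕ, j < l →
      z (i + j) = u ((m + j) % n) := fun z hz i l => by
    obtain ⟨y, hy, hyx, m, hm⟩ := h.occurs_after z hz i l
    refine ⟨m, fun j hj => ?_⟩
    rw [← hm j (by omega) (by omega), ← hu (tail y T)]
    · simp [tail, add_assoc]
    · rw [← followers_congr hyx]
      exact tail_mem_followers hy T
  have huc : ∀ i < n, u i = c 0 := fun i hi => by
    -- Length `2 * n` ensures that each position of the period is met, whatever the phase `m`.
    obtain ⟨m, hm⟩ := key c hc 0 (2 * n)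
    have hmn := Nat.mod_lt m hn
    have hdiv := Nat.div_add_mod m n
    have := hm (i + (n - m % n)) (by omega)
    rw [hc', show m + (i + (n - m % n)) = n * (m / n + 1) + i by rw [mul_add]; omega,
      Nat.mul_add_mod, Nat.mod_eq_of_lt hi] at this
    exact this.symm
  refine ⟨c, Set.eq_singleton_iff_unique_mem.2 ⟨hc, fun z hz => funext fun i => ?_⟩⟩
  obtain ⟨m, hm⟩ := key z hz i 1
  have := hm 0 (by omega)
  rw [hc', ← huc _ (Nat.mod_lt (m + 0) hn), ← this]
  simp

/-- Two distinct loops of the same length yield two configurations whose right-infinite parts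
form a strictly proximal pair. -/
lemma IsRecurrentAt.exists_proximal_pair (h : X.IsRecurrentAt x₀ T) {n : ℕ} {a b : ℕ → A}
    (ha : IsLoop (X.followers x₀ T) a n) (hb : IsLoop (X.followers x₀ T) b n)
    (hab : ∃ i < n, a i ≠ b i) :
    ∃ p ∈ X.carrier, ∃ q ∈ X.carrier, (∀ t < T, p t = x₀ t) ∧ (∀ t < T, q t = x₀ t) ∧
      (∀ N : ℕ, ∃ i ≥ N, p (T + (i : ℕ)) ≠ q (T + (i : ℕ))) ∧
      ∀ N : ℕ, ∃ i : ℕ, X.followers p (T + i) = X.followers q (T + i) ∧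
        ∀ j : ℕ, j < N → p (T + i + j) = q (T + i + j) := by
  obtain ⟨i, hi, hne⟩ := hab
  have hn : 0 < n := by omega
  classical
  -- The squares are infinite in number with unbounded gaps: the sequences differ infinitely often,
  -- yet agree on arbitrarily long stretches, starting at the common vertex reached after each
  -- block.
  set f : ℕ → Bool := fun m => decide (∃ t, t * t = m)
  refine ⟨splice x₀ T (blocks a b n fun _ => false), blocks_mem_followers hn h.mem ha hb _,
    splice x₀ T (blocks a b n f), blocks_mem_followers hn h.mem ha hb _,
    fun t ht => splice_of_lt ht, fun t ht => splice_of_lt ht, fun N => ?_, fun N => ?_⟩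
  · refine ⟨n * (N * N) + i, ?_, ?_⟩
    · nlinarith [Nat.le_mul_of_pos_left (N * N) hn, Nat.le_mul_self N]
    · rw [splice_add_nat, splice_add_nat, blocks_add hi, blocks_add hi]
      simpa [f] using hne
  · refine ⟨n * (N * N + 1), ?_, fun j hj => ?_⟩
    · have : ∀ g, X.followers (splice x₀ T (blocks a b n g)) (T + (n * (N * N + 1) : ℕ)) =
          X.followers x₀ T := fun g => followers_splice_loop (ha.blocks hb g _)
      rw [this, this]
    · have hf : f ((n * (N * N + 1) + j) / n) = false := by
        rw [Nat.mul_add_div hn]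
        have := Nat.div_le_self j n
        have := Nat.zero_le (j / n)
        simp only [f, decide_eq_false_iff_not]
        exact Nat.not_exists_sq (m := N) (by linarith) (by linarith)
      rw [add_assoc, ← Nat.cast_add, splice_add_nat, splice_add_nat]
      simp only [blocks, hf]

end Subshift

end SymbolicDynamics.FullShift

/-! ### Transfer of the proximal pair from the product to `X` -/

namespace SymbolicDynamics.FullShift.Subshift

variable {A B C : Type*} [TopologicalSpace A] [TopologicalSpace B] [TopologicalSpace C]
  {X : Subshift A ℤ} {W : Subshift B ℤ} {Y : Subshift B ℤ} {Z : Subshift C ℤ}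

lemma HasFixedPoint.of_isConjugacy {k : ℕ} {F : (ℤ → A) → ℤ → B} {G : (ℤ → B) → ℤ → A}
    (h : X.HasFixedPoint) (hc : X.IsConjugacy W k F G) : W.HasFixedPoint := by
  obtain ⟨x, hx, hfix⟩ := h
  refine ⟨F x, hc.fwd.maps x hx, fun i => hc.fwd.loc x hx x hx _ _ fun j _ => ?_⟩
  rw [show i + 1 + j = i + j + 1 by ring, hfix]

/-- If `X` is conjugate to `Y × Z`, where infinitely many follower sets occur in `Y` and `Z` is
nontrivial, then there is a strictly proximal pair of shortest right-infinite paths in `X`. -/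
lemma IsHalfSyncConfig.exists_shortest_proximal_pair [Finite B] {x₀ : ℤ → A} {L k : ℕ}
    {F : (ℤ → A) → ℤ → B × C} {G : (ℤ → B × C) → ℤ → A} (h : X.IsHalfSyncConfig x₀ L)
    (hc : X.IsConjugacy (Y.prod Z) k F G) (hfix : X.HasFixedPoint)
    (hinf : (Y.reachable (fun i => (F x₀ i).1) (3 * k)).Infinite) (hZ : ¬ Z.IsTrivial) :
    ∃ x ∈ X.carrier, ∃ y ∈ X.carrier, (∀ t < 0, x t = x₀ t) ∧ (∀ t < 0, y t = x₀ t) ∧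
      (∃ i₀, X.IsShortestFrom x i₀ ∧ X.IsShortestFrom y i₀) ∧
      (∀ N : ℕ, ∃ i : ℕ, N ≤ i ∧ x i ≠ y i) ∧
      ∀ N : ℕ, ∃ i : ℕ, X.followers x i = X.followers y i ∧
        ∀ j : ℕ, j < N → x (i + j) = y (i + j) := by
  obtain ⟨p, hp, hpx, hps⟩ := exists_isShortestFrom hinf
  have hrec := (h.isRecurrentAt hc).snd
  have hZfix : Z.HasFixedPoint := by
    obtain ⟨w, hw, hwfix⟩ := hfix.of_isConjugacy hc
    exact ⟨_, hw.2, fun i => by rw [hwfix]⟩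
  rcases hrec.exists_loops_or_periodic with ⟨n, a, b, ha, hb, hab⟩ | ⟨n, hn, u, hu⟩
  swap
  · exact absurd (hrec.isTrivial_of_periodic hZfix hn hu) hZ
  obtain ⟨q, hq, q', hq', hqx, hqx', hne, hagree⟩ := hrec.exists_proximal_pair ha hb hab
  have hpq : (fun i => (p i, q i)) ∈ (Y.prod Z).carrier := ⟨hp, hq⟩
  have hpq' : (fun i => (p i, q' i)) ∈ (Y.prod Z).carrier := ⟨hp, hq'⟩
  have hpast : ∀ w ∈ (Y.prod Z).carrier, (∀ t < (3 * k : ℤ), w t = F x₀ t) → ∀ t < 0,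
      G w t = x₀ t := fun w hw hwx t ht => by
    conv_rhs => rw [← hc.left_inv x₀ h.mem]
    exact hc.bwd.eq_of_agree_lt hw (hc.fwd.maps _ h.mem) hwx (by omega)
  refine ⟨_, hc.bwd.maps _ hpq, _, hc.bwd.maps _ hpq',
    hpast _ hpq fun t ht => Prod.ext (hpx t ht) (hqx t ht),
    hpast _ hpq' fun t ht => Prod.ext (hpx t ht) (hqx' t ht),
    ⟨_, (hps.prod hp hq).image hc hpq, (hps.prod hp hq').image hc hpq'⟩, fun N => ?_, fun N => ?_⟩
  · by_contra! hcon
    obtain ⟨i, hi, hqq⟩ := hne (N + k)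
    refine hqq ?_
    have := hc.fwd.eq_of_agree (s := 3 * k + i) (t := 3 * k + i) (hc.bwd.maps _ hpq)
      (hc.bwd.maps _ hpq') fun j h₁ h₂ => by
        have := hcon (3 * k + i + j).toNat (by omega)
        rwa [Int.toNat_of_nonneg (by omega)] at this
    rw [hc.right_inv _ hpq, hc.right_inv _ hpq'] at this
    exact congrArg Prod.snd this
  -- The delay `3 * k` and the radius `k` of `G` use up `4 * k` symbols; the rest is slack.
  · obtain ⟨i, hfol, hi⟩ := hagree (N + 4 * k + k)
    have hW : (Y.prod Z).followers (fun i => (p i, q i)) (3 * k + i) =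
        (Y.prod Z).followers (fun i => (p i, q' i)) (3 * k + i) :=
      (followers_prod_eq_iff hpq hpq').2 ⟨rfl, hfol⟩
    have hagr : ∀ j : ℤ, 0 ≤ j → j < N + 4 * k + k →
        (p (3 * k + i + j), q (3 * k + i + j)) = (p (3 * k + i + j), q' (3 * k + i + j)) :=
      fun j h₁ h₂ => by
        have := hi j.toNat (by omega)
        rw [Int.toNat_of_nonneg h₁] at this
        rw [this]
    refine ⟨3 * k + i + 3 * k, ?_, fun j hj => ?_⟩
    · push_cast
      exact hc.symm.followers_eq hpq hpq' hW fun j h₁ h₂ => hagr j h₁ (by omega)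
    · push_cast
      refine hc.bwd.eq_of_agree hpq hpq' fun l h₁ h₂ => ?_
      have := hagr (3 * k + j + l) (by omega) (by omega)
      rwa [show (3 * k + i + (3 * k + j + l) : ℤ) = 3 * k + i + 3 * k + j + l by ring] at this

end SymbolicDynamics.FullShift.Subshift

/-! ### Paths in directed graphs -/

namespace DirGraph

variable {V E : Type*} {G : DirGraph V E}

lemma isPathFromTo_ofFn {e : ℕ → E} (he : ∀ k, G.term (e k) = G.init (e (k + 1))) (n : ℕ) :
    G.IsPathFromTo (G.init (e 0)) (G.term (e n)) (List.ofFn fun k : Fin (n + 1) => e k) := by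
  refine ⟨?_, by simp, ?_, ?_⟩
  · rw [List.isChain_iff_getElem]
    intro i hi
    simp only [List.getElem_ofFn]
    exact he i
  · simp
  · rw [List.getLast_ofFn]
    rfl

lemma IsPathFromTo.of_induce {S : Set V} {u v : S} {p : List {e : E // G.init e ∈ S ∧ G.term e ∈ S}}
    (h : (G.induce S).IsPathFromTo u v p) : G.IsPathFromTo u v (p.map Subtype.val) := by
  obtain ⟨hc, hp, hu, hv⟩ := h
  refine ⟨?_, mt List.map_eq_nil_iff.1 hp, ?_, ?_⟩
  · rw [List.isChain_map]
    exact hc.imp fun e f hef => congrArg Subtype.val hef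
  · rw [List.head_map]
    exact congrArg Subtype.val hu
  · rw [List.getLast_map]
    exact congrArg Subtype.val hv

/-- If every vertex has an incoming edge, then every vertex ends a left-infinite path. -/
lemma exists_left_path (h : ∀ v, ∃ e, G.term e = v) (v : V) :
    ∃ e : ℕ → E, G.term (e 0) = v ∧ ∀ n, G.term (e (n + 1)) = G.init (e n) := by
  choose f hf using h
  exact ⟨fun n => Nat.rec (f v) (fun _ e => f (G.init e)) n, hf v, fun n => hf _⟩

lemma glue_mem_biPaths {l r : ℕ → E} (hl : ∀ n, G.term (l (n + 1)) = G.init (l n))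
    (hr : ∀ n, G.term (r n) = G.init (r (n + 1))) (h : G.term (l 0) = G.init (r 0)) :
    SymbolicDynamics.FullShift.glue l r ∈ G.biPaths := by
  intro i
  match i with
  | Int.ofNat n => exact hr n
  | Int.negSucc 0 => exact h
  | Int.negSucc (n + 1) => exact hl n

end DirGraph

/-! ### From configurations to words and to paths of the Fischer graph -/

namespace SymbolicDynamics.FullShift

section Words

variable {A : Type*}

lemma length_subword (x : ℤ → A) (i : ℤ) (n : ℕ) : (subword x i n).length = n := by
  simp [subword]

lemma getElem_subword (x : ℤ → A) (i : ℤ) (n k : ℕ) (hk : k < (subword x i n).length) :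
    (subword x i n)[k] = x (i + k) := by
  simp [subword]

lemma leftSubword_leftRay (x : ℤ → A) (m n : ℕ) :
    leftSubword (leftRay x) m n = subword x (-(m + n)) n := by
  refine List.ext_getElem (by simp [leftSubword, subword]) fun i h₁ h₂ => ?_
  rw [length_subword] at h₂
  rw [getElem_subword]
  simp only [leftSubword, leftRay, List.getElem_reverse, List.getElem_ofFn, List.length_ofFn]
  congr 1
  omega

lemma leftSnoc_leftRay (x : ℤ → A) : leftSnoc (leftRay x) (x 0) = leftRay (shift 1 x) := by
  funext n
  cases n with
  | zero => rfl
  | succ n =>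
    simp only [leftSnoc, leftRay, shift]
    congr 1

end Words

namespace Subshift

variable {A : Type*} [TopologicalSpace A] {X : Subshift A ℤ}

lemma subword_mem_language {x : ℤ → A} (hx : x ∈ X.carrier) (i : ℤ) (n : ℕ) :
    subword x i n ∈ X.language := ⟨x, hx, i, n, rfl⟩

/-- Transitivity is needed only for `occurs_after`; the rest unpacks the witness of `s`. -/
lemma IsHalfSynchronizing.exists_config {s : List A} (hs : X.IsHalfSynchronizing s)
    (hX : X.IsTransitive) :
    ∃ x₀, X.IsHalfSyncConfig x₀ s.length ∧ X.followers x₀ 0 = X.wordFollower s := by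
  obtain ⟨hsL, _, ⟨x₀, hx₀, rfl⟩, hsuf, hlang, hfol⟩ := hs
  rw [rayFollower_leftRay] at hfol
  rw [leftSubword_leftRay] at hsuf
  have hget : ∀ (k : ℕ) (hk : k < s.length), s[k] = x₀ (-s.length + k) := fun k hk => by
    have := getElem_subword x₀ (-((0 : ℕ) + s.length)) s.length k (by rwa [length_subword])
    simp only [hsuf] at this
    simpa using this
  refine ⟨x₀, ⟨hx₀, fun z hz hzx => ?_, fun x hx i n => ?_, fun x hx i n => ?_⟩, hfol⟩
  · rw [hfol]
    refine ⟨⟨z, hz, rightRay_eq_tail z⟩, _, X.shift_mem hz (-s.length), ?_⟩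
    funext n
    simp only [rightRay, shift, prepend, Int.ofNat_eq_natCast]
    split_ifs with hn
    · rw [hget n hn, hzx _ (by omega) (by omega)]
    · rw [tail]
      congr 1
      omega
  · have := subword_mem_language hx i n
    rw [← hlang] at this
    obtain ⟨m, n', h⟩ := this
    rw [leftSubword_leftRay] at h
    obtain rfl : n' = n := by rw [← length_subword x₀ (-(m + n')) n', h, length_subword]
    refine ⟨m, fun j h₁ h₂ => ?_⟩
    have e₁ := getElem_subword x₀ (-(m + n')) n' j.toNat (by rw [length_subword]; omega)
    have e₂ := getElem_subword x i n' j.toNat (by rw [length_subword]; omega)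
    simp only [h] at e₁
    rw [e₁, Int.toNat_of_nonneg h₁] at e₂
    exact e₂
  · obtain ⟨w, -, z, hz, t, l, h⟩ := hX s hsL _ (subword_mem_language hx i n)
    rw [List.append_assoc] at h
    have hl : l = s.length + w.length + n := by
      rw [← length_subword z t l, h]
      simp [length_subword, add_assoc]
    have hz' : ∀ (k : ℕ) (hk : k < (s ++ (w ++ subword x i n)).length),
        (s ++ (w ++ subword x i n))[k] = z (t + k) := fun k hk => by
      have := getElem_subword z t l k (by rwa [h])
      simp only [h] at this
      exact this
    refine ⟨_, X.shift_mem hz (t + s.length), fun j h₁ h₂ => ?_, w.length, fun j h₁ h₂ => ?_⟩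
    · have := hz' (j + s.length).toNat (by simp only [List.length_append]; omega)
      rw [List.getElem_append_left (by omega), hget] at this
      rw [shift]
      convert this.symm using 2 <;> omega
    · have := hz' (s.length + w.length + j.toNat)
        (by simp only [List.length_append, length_subword]; omega)
      rw [List.getElem_append_right (by omega), List.getElem_append_right (by omega),
        getElem_subword] at this
      rw [shift]
      convert this.symm using 2
      · push_cast
        omega
      · omega

/-! ### Paths of the Krieger graph -/

/-- The follower set of `x[-∞, i - 1]` as a vertex of the Krieger graph. -/
def vertexAt {x : ℤ → A} (hx : x ∈ X.carrier) (i : ℤ) : X.kriegerVertices :=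
  ⟨X.followers x i, leftRay (shift i x), ⟨_, X.shift_mem hx i, rfl⟩, by
    rw [rayFollower_leftRay, followers_shift, add_zero]⟩

/-- The edge of the Krieger graph given by `x[-∞, i]`. -/
def edgeAt {x : ℤ → A} (hx : x ∈ X.carrier) (i : ℤ) : X.kriegerEdges :=
  ⟨(vertexAt hx i, x i, vertexAt hx (i + 1)), leftRay (shift i x), ⟨_, X.shift_mem hx i, rfl⟩, by
    have h : leftSnoc (leftRay (shift i x)) (x i) = leftRay (shift 1 (shift i x)) := by
      rw [← leftSnoc_leftRay]
      simp [shift]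
    refine ⟨⟨_, X.shift_mem (X.shift_mem hx i) 1, h.symm⟩, ?_, ?_⟩
    · rw [rayFollower_leftRay, followers_shift, add_zero]
      rfl
    · rw [h, rayFollower_leftRay, followers_shift, followers_shift, add_zero]
      rfl⟩

lemma reaches_vertexAt {x : ℤ → A} (hx : x ∈ X.carrier) {i j : ℤ} (hij : i < j) :
    X.kriegerGraph.Reaches (vertexAt hx i) (vertexAt hx j) := by
  have := DirGraph.isPathFromTo_ofFn (G := X.kriegerGraph) (e := fun k : ℕ => edgeAt hx (i + k))
    (fun k => by
      show vertexAt hx (i + k + 1) = vertexAt hx (i + (k + 1 : ℕ))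
      congr 1
      push_cast
      ring) (j - i - 1).toNat
  have hi : X.kriegerGraph.init (edgeAt hx (i + (0 : ℕ))) = vertexAt hx i := by
    show vertexAt hx (i + (0 : ℕ)) = vertexAt hx i
    simp
  have hj : X.kriegerGraph.term (edgeAt hx (i + (j - i - 1).toNat)) = vertexAt hx j := by
    show vertexAt hx (i + (j - i - 1).toNat + 1) = vertexAt hx j
    congr 1
    omega
  rw [hi, hj] at this
  exact ⟨_, this⟩

lemma exists_config_of_edge (e : X.kriegerEdges) : ∃ x ∈ X.carrier,
    X.followers x 0 = (X.kriegerGraph.init e).1 ∧ X.followers x 1 = (X.kriegerGraph.term e).1 := by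
  obtain ⟨⟨u, a, v⟩, _, ⟨x, hx, rfl⟩, ⟨y, hy, hyx⟩, hu, hv⟩ := e
  have hpast : ∀ t < 0, shift (-1) y t = x t := fun t ht => by
    have := congrFun hyx ((-t).toNat - 1 + 1)
    simp only [leftSnoc, leftRay] at this
    show y (-1 + t) = x t
    convert this using 2 <;> omega
  refine ⟨_, X.shift_mem hy (-1), ?_, ?_⟩
  · rw [followers_congr hpast, ← rayFollower_leftRay]
    exact hu.symm
  · rw [followers_shift, neg_add_cancel, ← rayFollower_leftRay]
    exact (congrArg X.rayFollower hyx).trans hv.symm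

/-- Paths of the Krieger graph are labeled by words that may follow a given left-infinite
sequence. -/
lemma exists_config_of_isPathFromTo {u v : X.kriegerVertices} {p : List X.kriegerEdges}
    (hp : X.kriegerGraph.IsPathFromTo u v p) {x : ℤ → A} {i : ℤ} (hu : X.followers x i = u.1) :
    ∃ y ∈ X.carrier, (∀ t < i, y t = x t) ∧ X.followers y (i + p.length) = v.1 := by
  induction p generalizing u x i with
  | nil => exact absurd rfl hp.2.1
  | cons e p ih =>
    obtain ⟨hc, hne, hinit, hterm⟩ := hp
    obtain ⟨z, hz, hz₀, hz₁⟩ := exists_config_of_edge e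
    have hxz : X.followers x i = X.followers z 0 := by
      rw [hz₀, hu, ← hinit]
      rfl
    have hy := splice_tail_mem hxz hz
    have hy₁ : X.followers (splice x i (tail z 0)) (i + 1) = (X.kriegerGraph.term e).1 := by
      have := followers_add_eq ((followers_splice x i (tail z 0)).trans hxz) 1
        fun j _ => splice_add_nat _ _ _ j
      simpa [hz₁] using this
    rcases eq_or_ne p [] with rfl | hpne
    · exact ⟨_, hy, fun t ht => splice_of_lt ht, by simpa [← hterm] using hy₁⟩
    · have hp' : X.kriegerGraph.IsPathFromTo (X.kriegerGraph.term e) v p := by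
        refine ⟨hc.tail, hpne, ?_, ?_⟩
        · obtain ⟨f, p, rfl⟩ := List.exists_cons_of_ne_nil hpne
          exact (List.isChain_cons_cons.1 hc).1.symm
        · rw [← hterm, List.getLast_cons hpne]
      obtain ⟨w, hw, hwy, hfol⟩ := ih hp' hy₁
      refine ⟨w, hw, fun t ht => ?_, ?_⟩
      · rw [hwy t (by omega), splice_of_lt ht]
      · rw [← hfol, List.length_cons]
        congr 1
        push_cast
        ring

/-- A strictly proximal pair of shortest right-infinite paths yields a strictly proximal pair of
eventually geodesic paths of the Fischer graph. -/
lemma IsHalfSyncConfig.hasEventuallyGeodesicStrictlyProximalPair {x₀ : ℤ → A} {L : ℕ}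
    (h : X.IsHalfSyncConfig x₀ L) {s : List A} (hs : X.IsHalfSynchronizing s)
    (hfol : X.followers x₀ 0 = X.wordFollower s) {x y : ℤ → A} (hx : x ∈ X.carrier)
    (hy : y ∈ X.carrier) (hxx : ∀ t < 0, x t = x₀ t) (hyx : ∀ t < 0, y t = x₀ t) {i₀ : ℤ}
    (hgx : X.IsShortestFrom x i₀) (hgy : X.IsShortestFrom y i₀)
    (hne : ∀ N : ℕ, ∃ i : ℕ, N ≤ i ∧ x i ≠ y i)
    (hagree : ∀ N : ℕ, ∃ i : ℕ, X.followers x i = X.followers y i ∧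
      ∀ j : ℕ, j < N → x (i + j) = y (i + j)) :
    (X.fischerGraph s hs).HasEventuallyGeodesicStrictlyProximalPair := by
  have hbase : ∀ {z : ℤ → A} (hz : z ∈ X.carrier), (∀ t < 0, z t = x₀ t) →
      vertexAt hz 0 = X.wordVertex s hs := fun hz hzx =>
    Subtype.ext ((followers_congr hzx).trans hfol)
  have hback : ∀ {z : ℤ → A} (hz : z ∈ X.carrier), (∀ t < 0, z t = x₀ t) → ∀ i : ℕ,
      X.kriegerGraph.Reaches (vertexAt hz i) (X.wordVertex s hs) := fun {z} hz hzx i => by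
    obtain ⟨w, hw, hwz, M, hM, hfolM⟩ := h.exists_return hz hzx (i + 1)
    have := reaches_vertexAt hw (i := i) (j := M) (by omega)
    rwa [show vertexAt hw i = vertexAt hz i from
      Subtype.ext (followers_congr fun t ht => hwz t (by push_cast; omega)),
      show vertexAt hw M = X.wordVertex s hs from Subtype.ext (hfolM.trans hfol)] at this
  have hcomp : ∀ {z : ℤ → A} (hz : z ∈ X.carrier), (∀ t < 0, z t = x₀ t) → ∀ i : ℕ,
      vertexAt hz i ∈ X.kriegerGraph.component (X.wordVertex s hs) := fun {z} hz hzx i => by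
    refine ⟨hback hz hzx i, ?_⟩
    rcases Nat.eq_zero_or_pos i with rfl | hi
    · have := hback hz hzx 0
      rw [Nat.cast_zero, hbase hz hzx] at this ⊢
      exact this
    · rw [← hbase hz hzx]
      exact reaches_vertexAt hz (by omega)
  let edge : ∀ {z : ℤ → A} (hz : z ∈ X.carrier), (∀ t < 0, z t = x₀ t) → ℕ →
      {e : X.kriegerEdges // X.kriegerGraph.init e ∈ X.kriegerGraph.component (X.wordVertex s hs) ∧
        X.kriegerGraph.term e ∈ X.kriegerGraph.component (X.wordVertex s hs)} :=
    fun hz hzx i => ⟨edgeAt hz i, hcomp hz hzx i, hcomp hz hzx (i + 1)⟩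
  have hin : ∀ v, ∃ e, (X.fischerGraph s hs).term e = v := by
    rintro ⟨v, -, p, hp⟩
    obtain ⟨z, hz, hzx, hzv⟩ := exists_config_of_isPathFromTo hp hfol
    have hpos : 0 < p.length := List.length_pos_iff.2 hp.2.1
    refine ⟨edge hz hzx (p.length - 1), Subtype.ext (Subtype.ext ?_)⟩
    rw [← hzv]
    show X.followers z _ = X.followers z _
    congr 1
    omega
  have hmem := hcomp hx hxx 0
  rw [Nat.cast_zero, hbase hx hxx] at hmem
  -- The path read along the past of `x₀` is not known to stay in the component, so any
  -- left-infinite path of the Fischer graph ending at the base vertex replaces it. Both conditions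
  -- on the pair concern only large coordinates.
  obtain ⟨l, hl₀, hl⟩ := DirGraph.exists_left_path hin ⟨X.wordVertex s hs, hmem⟩
  let path : ∀ {z : ℤ → A} (hz : z ∈ X.carrier), (∀ t < 0, z t = x₀ t) → ℤ → _ :=
    fun hz hzx => glue l (edge hz hzx)
  have hpath : ∀ {z : ℤ → A} (hz : z ∈ X.carrier) (hzx : ∀ t < 0, z t = x₀ t),
      path hz hzx ∈ (X.fischerGraph s hs).biPaths := fun hz hzx =>
    DirGraph.glue_mem_biPaths hl (fun n => rfl) (hl₀.trans (Subtype.ext (hbase hz hzx).symm))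
  have hgeo : ∀ {z : ℤ → A} (hz : z ∈ X.carrier) (hzx : ∀ t < 0, z t = x₀ t),
      X.IsShortestFrom z i₀ → (X.fischerGraph s hs).IsEventuallyGeodesic (path hz hzx) :=
    fun {z} hz hzx hgz => by
      refine ⟨hpath hz hzx, max i₀ 0, fun i hi n => ?_⟩
      obtain ⟨m, rfl⟩ := Int.eq_ofNat_of_zero_le (le_of_max_le_right hi)
      refine ⟨_, _, DirGraph.isPathFromTo_ofFn (G := X.fischerGraph s hs)
        (e := fun k => edge hz hzx (m + k)) (fun k => rfl) n, fun q hq => ?_⟩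
      -- A competing path depends only on its initial vertex, so it can be read after the actual
      -- past of `z`.
      obtain ⟨w, hw, hwz, hwfol⟩ := exists_config_of_isPathFromTo hq.of_induce (x := z) (i := m) rfl
      have := hgz m (le_of_max_le_left hi) (m + n + 1) (by omega) w hw _ hwz hwfol
      rw [List.length_map] at this
      rw [List.length_ofFn]
      omega
  refine ⟨path hx hxx, path hy hyx, hgeo hx hxx hgx, hgeo hy hyx hgy,
    ⟨hpath hx hxx, hpath hy hyx, fun n => ?_⟩, fun N => ?_⟩
  · obtain ⟨i, hi, hij⟩ := hagree (n + 1)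
    -- Equal labels alone do not give equal edges; the common vertex at `i` propagates along the
    -- common word.
    have hv : ∀ k ≤ n + 1, X.followers x (i + k : ℕ) = X.followers y (i + k : ℕ) := fun k hk => by
      push_cast
      exact followers_add_eq hi k fun j hj => hij j (by omega)
    refine ⟨i, fun k hk => Subtype.ext (Subtype.ext (Prod.ext (Subtype.ext (hv k (by omega)))
      (Prod.ext ?_ (Subtype.ext (hv (k + 1) (by omega))))))⟩
    exact hij k (by omega)
  · obtain ⟨i, hi, hxy⟩ := hne N
    exact ⟨i, hi, fun heq => hxy (congrArg (fun e => e.1.1.2.1) heq)⟩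

end Subshift

end SymbolicDynamics.FullShift

/-! ### Symmetry of the factors and conclusion -/

namespace SymbolicDynamics.FullShift.Subshift

variable {A B C : Type*} [TopologicalSpace A] [TopologicalSpace B] [TopologicalSpace C]

/-- The two factors of a product may be interchanged. -/
lemma IsConjugacy.prod_swap {X : Subshift A ℤ} {Y : Subshift B ℤ} {Z : Subshift C ℤ} {k : ℕ}
    {F : (ℤ → A) → ℤ → B × C} {G : (ℤ → B × C) → ℤ → A} (h : X.IsConjugacy (Y.prod Z) k F G) :
    X.IsConjugacy (Z.prod Y) k (fun x i => (F x i).swap) (fun w => G fun i => (w i).swap) where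
  fwd := ⟨fun x hx => (h.fwd.maps x hx).symm, fun x hx y hy s t hxy =>
    congrArg Prod.swap (h.fwd.loc x hx y hy s t hxy)⟩
  bwd := ⟨fun w hw => h.bwd.maps _ hw.symm, fun v hv w hw s t hvw =>
    h.bwd.loc _ hv.symm _ hw.symm s t fun j hj => congrArg Prod.swap (hvw j hj)⟩
  left_inv x hx := h.left_inv x hx
  right_inv w hw := by
    rw [h.right_inv _ hw.symm]
    rfl

lemma IsHalfSyncConfig.isTrivial_of_reachable_infinite [Finite B] {X : Subshift A ℤ}
    {Y : Subshift B ℤ} {Z : Subshift C ℤ} {x₀ : ℤ → A} {L k : ℕ}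
    {F : (ℤ → A) → ℤ → B × C} {G : (ℤ → B × C) → ℤ → A} (h : X.IsHalfSyncConfig x₀ L)
    {s : List A} (hs : X.IsHalfSynchronizing s) (hfol : X.followers x₀ 0 = X.wordFollower s)
    (hF : ¬ (X.fischerGraph s hs).HasEventuallyGeodesicStrictlyProximalPair)
    (hc : X.IsConjugacy (Y.prod Z) k F G) (hfix : X.HasFixedPoint)
    (hinf : (Y.reachable (fun i => (F x₀ i).1) (3 * k)).Infinite) : Z.IsTrivial := by
  by_contra hZ
  obtain ⟨x, hx, y, hy, hxx, hyx, ⟨i₀, hgx, hgy⟩, hne, hagree⟩ :=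
    h.exists_shortest_proximal_pair hc hfix hinf hZ
  exact hF (h.hasEventuallyGeodesicStrictlyProximalPair hs hfol hx hy hxx hyx hgx hgy hne hagree)

end SymbolicDynamics.FullShift.Subshift

theorem mainTheorem1 {A : Type u} [Finite A] [TopologicalSpace A] [DiscreteTopology A]
    (X : SymbolicDynamics.FullShift.Subshift A ℤ)
    (hX : X.IsHalfSynchronized) (hsofic : ¬ X.IsSofic) (hfix : X.HasFixedPoint)
    (s : List A) (hs : X.IsHalfSynchronizing s)
    (hF : ¬ (X.fischerGraph s hs).HasEventuallyGeodesicStrictlyProximalPair) :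
    SymbolicDynamics.FullShift.Subshift.IsDirectPrime.{u, v, w} X := by
  intro B C _ _ _ _ _ _ Y Z _ _ hconj
  obtain ⟨x₀, h, hfol⟩ := hs.exists_config hX.1
  obtain ⟨k, F, G, hc⟩ := hconj.exists_isConjugacy ⟨x₀, h.mem⟩
  have hinf := h.reachable_infinite hc fun hfin => hsofic (h.isSofic hfin)
  rcases SymbolicDynamics.FullShift.Subshift.reachable_prod_infinite hinf with hY | hZ
  · exact Or.inr (h.isTrivial_of_reachable_infinite hs hfol hF hc hfix hY)
  · exact Or.inl (h.isTrivial_of_reachable_infinite hs hfol hF hc.prod_swap hfix hZ)
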